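/- Let $d\ge 1$, and for Schwartz functions $f$ on $\mathbb R^d$ let $$e^{it\sqrt{-\Delta}}f(x)=\frac1{(2\pi)^d}\int_{\mathbb R^d}\widehat f(\xi)e^{i\langle x,\xi\rangle+it|\xi|}\,d\xi,\qquad \widehat f(\xi)=\int_{\mathbb R^d} f(y)e^{-i\langle y,\xi\rangle}\,dy .$$ Fix a real-valued $\varphi\in C_c^\infty((\tfrac14,4))$, not identically zero, and let $P_j=\varphi(2^{-j}|D|)$ be the Fourier multiplier operator with symbol $\varphi(2^{-j}|\xi|)$. For bounded $A\subset\mathbb R$ let $N(A,\delta)$ be the minimal number of closed intervals of length $\delta$ needed to cover $A$. A $2^{-j}$-discretization of $E$ is a maximal $2^{-j}$-separated subset $E_j$ of $E$ (distinct points have distance at least $2^{-j}$). For nonempty bounded $E\subset\mathbb R$ put $$\nu_E^\sharp(\alpha)=\limsup_{\delta\to0+}\frac{\log\big(\sup_{\delta\le|I|\le1}|I|^{-\alpha}N(E\cap I,\delta)\big)}{\log(1/\delta)},$$ $$s_E(p,q)=\tfrac{d+1}2\big(\tfrac1p-\tfrac1q\big)+\tfrac1q\,\nu_E^\sharp\big(\tfrac{q(d-1)}2(1-\tfrac1p-\tfrac1q)\big),$$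 where $I$ runs over intervals of length $|I|$. Write $p'$ for the exponent conjugate to $p$. Suprema below are over Schwartz functions $f$. (i) There is $\rho_0\in(0,1)$, depending only on $d$ and $\varphi$, and for every $q\in(1,\infty)$ there is $c(q)>0$, depending only on $q,d,\varphi$, such that the following holds for every $\rho\in(0,\rho_0]$. For all $1\le p<\infty$ with $q>p'$, all $E\subset[1,2]$, all integers $j\ge0$, all $2^{-j}$-discretizations $E_j$ of $E$ and all intervals $I$ with $2^j\ge2^j|I|\ge\rho^{-1}$, both $$\sup_{\|f\|_p\le1}\Big(\sum_{t\in E_j}\|e^{it\sqrt{-\Delta}}f\|_q^q\Big)^{1/q}\quad\text{and}\quad \sup_{\|f\|_p\le1}\Big(\sum_{t\in E_j}\|e^{it\sqrt{-\Delta}}P_jf\|_q^q\Big)^{1/q}$$ are at least $$c(q)\,\rho^{\frac dq}\,\frac{N(E\cap I,2^{-j})^{\frac1q}\,2^{j\frac{d+1}2(\frac1p-\frac1q)}}{|I|^{\frac{d-1}2(1-\frac1p-\frac1q)}} .$$ (ii) Let $E\subset[1,2]$ be nonempty, let $E_j$ be a $2^{-j}$-discretization of $E$ for each $j$, and let $1\le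 p<\infty$, $p'<q<\infty$. If $s<s_E(p,q)$, there is no constant $C$ such that $\big(\sum_{t\in E_j}\|e^{it\sqrt{-\Delta}}P_jf\|_q^q\big)^{1/q}\le C2^{js}\|f\|_p$ for all $j\ge1$ and all Schwartz $f$. (iii) Let $E$ and $E_j$ be as in (ii) and let $2\le r\le q<\infty$. If $s<s_E(2,q)$, there is no constant $C$ such that $\big\|\big(\sum_{t\in E_j}|e^{-it\sqrt{-\Delta}}P_jf|^r\big)^{1/r}\big\|_q\le C2^{js}\|f\|_2$ for all $j\ge1$ and all Schwartz $f$. -/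

import Mathlib

open Set Filter MeasureTheory
open scoped Topology ENNReal NNReal SchwartzMap ContDiff

noncomputable section

namespace FractalWave

/-- `ℝ^d` with the Euclidean norm and Lebesgue measure. -/
abbrev Space (d : ℕ) : Type := EuclideanSpace ℝ (Fin d)

/-- The Fourier transform `f̂(ξ) = ∫ f(y) e^{-i⟨y,ξ⟩} dy`. -/
def fourierHat {d : ℕ} (f : Space d → ℂ) (ξ : Space d) : ℂ :=
  ∫ y : Space d, f y * Complex.exp (-(Complex.I * ((inner ℝ y ξ : ℝ) : ℂ)))

/-- The Fourier multiplier operator with symbol `m`: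
`(2π)^{-d} ∫ m(ξ) f̂(ξ) e^{i⟨x,ξ⟩} dξ`. -/
def multiplierOp {d : ℕ} (m : Space d → ℂ) (f : Space d → ℂ) (x : Space d) : ℂ :=
  ((((2 * Real.pi) ^ d)⁻¹ : ℝ) : ℂ) *
    ∫ ξ : Space d, m ξ * fourierHat f ξ * Complex.exp (Complex.I * ((inner ℝ x ξ : ℝ) : ℂ))

/-- The half-wave propagator `e^{it√-Δ}`, the multiplier operator with symbol `e^{it|ξ|}`. -/
def halfWave {d : ℕ} (t : ℝ) (f : Space d → ℂ) : Space d → ℂ :=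
  multiplierOp (fun ξ => Complex.exp (Complex.I * ((t * ‖ξ‖ : ℝ) : ℂ))) f

/-- The frequency-localized propagator `e^{it√-Δ} P_j` with `P_j = φ(2^{-j}|D|)`, the multiplier
operator with symbol `e^{it|ξ|} φ(2^{-j}|ξ|)`. -/
def halfWaveLoc {d : ℕ} (φ : ℝ → ℝ) (j : ℕ) (t : ℝ) (f : Space d → ℂ) : Space d → ℂ :=
  multiplierOp (fun ξ => Complex.exp (Complex.I * ((t * ‖ξ‖ : ℝ) : ℂ)) *
    ((φ (((2 : ℝ) ^ j)⁻¹ * ‖ξ‖) : ℝ) : ℂ)) f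

/-- `F` is a `δ`-discretization of `E`: a maximal `δ`-separated subset of `E`. (For bounded `E`
and `δ > 0` every such subset is finite.) -/
def IsDiscretization (E : Set ℝ) (δ : ℝ) (F : Finset ℝ) : Prop :=
  Maximal (fun S : Set ℝ => S ⊆ E ∧ S.Pairwise fun s t => δ ≤ |s - t|) (F : Set ℝ)

/-- `I` is a (closed, open or half-open) bounded interval of length `ℓ`. -/
def IsIntervalOfLength (I : Set ℝ) (ℓ : ℝ) : Prop :=
  ∃ a : ℝ, Ioo a (a + ℓ) ⊆ I ∧ I ⊆ Icc a (a + ℓ)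

/-- `N(A, δ)`: the minimal number of closed intervals of length `δ` (closed balls of radius `δ/2`)
needed to cover the bounded set `A ⊆ ℝ`. -/
def coverN (A : Set ℝ) (δ : ℝ) : ℕ :=
  (Metric.externalCoveringNumber (δ / 2).toNNReal A).toNat

/-- The Legendre–Assouad function
`ν_E^♯(α) = limsup_{δ → 0+} log (sup_{δ ≤ |I| ≤ 1} |I|^{-α} N(E ∩ I, δ)) / log (1/δ)`
of a nonempty bounded set `E`. -/
def legendreAssouad (E : Set ℝ) (α : ℝ) : ℝ :=
  limsup (fun δ : ℝ =>
    Real.log (sSup {y : ℝ | ∃ (I : Set ℝ) (ℓ : ℝ), IsIntervalOfLength I ℓ ∧ δ ≤ ℓ ∧ ℓ ≤ 1 ∧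
      y = ℓ ^ (-α) * (coverN (E ∩ I) δ : ℝ)}) / Real.log (1 / δ)) (𝓝[>] 0)

/-- `s_E(p,q) = (d+1)/2 (1/p - 1/q) + (1/q) ν_E^♯(q(d-1)/2 (1 - 1/p - 1/q))`. -/
def criticalExponent (d : ℕ) (E : Set ℝ) (p q : ℝ) : ℝ :=
  ((d : ℝ) + 1) / 2 * (1 / p - 1 / q)
    + 1 / q * legendreAssouad E (q * ((d : ℝ) - 1) / 2 * (1 - 1 / p - 1 / q))

/-- `(∑_{t ∈ F} ‖T_t f‖_q^q)^{1/q}`. -/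
def mixedNorm {d : ℕ} (q : ℝ) (F : Finset ℝ) (T : ℝ → (Space d → ℂ) → Space d → ℂ)
    (f : Space d → ℂ) : ℝ≥0∞ :=
  (∑ t ∈ F, eLpNorm (T t f) (ENNReal.ofReal q) volume ^ q) ^ (1 / q)

/-- The `L^p → ℓ^q_F(L^q)` norm of the family `(T_t)_{t ∈ F}`, tested on Schwartz functions:
`sup_{‖f‖_p ≤ 1} (∑_{t ∈ F} ‖T_t f‖_q^q)^{1/q}`. -/
def opNorm {d : ℕ} (p q : ℝ) (F : Finset ℝ) (T : ℝ → (Space d → ℂ) → Space d → ℂ) : ℝ≥0∞ :=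
  ⨆ (f : 𝓢(Space d, ℂ)) (_ : eLpNorm (⇑f) (ENNReal.ofReal p) volume ≤ 1), mixedNorm q F T ⇑f

/-- The quantity `N(E ∩ I, 2^{-j})^{1/q} 2^{j (d+1)/2 (1/p - 1/q)} / |I|^{(d-1)/2 (1 - 1/p - 1/q)}`
for an interval `I` of length `ℓ`. -/
def lowerQuantity (d : ℕ) (p q : ℝ) (E : Set ℝ) (j : ℕ) (I : Set ℝ) (ℓ : ℝ) : ℝ :=
  (coverN (E ∩ I) ((2 : ℝ) ^ j)⁻¹ : ℝ) ^ (1 / q)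
      * (2 : ℝ) ^ ((j : ℝ) * (((d : ℝ) + 1) / 2) * (1 / p - 1 / q))
    / ℓ ^ (((d : ℝ) - 1) / 2 * (1 - 1 / p - 1 / q))

/-- The estimate `(∑_{t ∈ E_j} ‖e^{it√-Δ} P_j f‖_q^q)^{1/q} ≤ C 2^{js} ‖f‖_p` holds for all
`j ≥ 1` and all Schwartz `f`, with `C` independent of `j` and `f`. -/
def SmoothingEstimate (d : ℕ) (φ : ℝ → ℝ) (Ej : ℕ → Finset ℝ) (p q s : ℝ) : Prop :=
  ∃ C : ℝ, ∀ j : ℕ, 1 ≤ j → ∀ f : 𝓢(Space d, ℂ),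
    mixedNorm q (Ej j) (halfWaveLoc φ j) ⇑f
      ≤ ENNReal.ofReal (C * (2 : ℝ) ^ ((j : ℝ) * s)) * eLpNorm (⇑f) (ENNReal.ofReal p) volume

/-- The estimate `‖(∑_{t ∈ E_j} |e^{-it√-Δ} P_j f|^r)^{1/r}‖_q ≤ C 2^{js} ‖f‖_2` holds for all
`j ≥ 1` and all Schwartz `f`, with `C` independent of `j` and `f`. -/
def SquareFunctionEstimate (d : ℕ) (φ : ℝ → ℝ) (Ej : ℕ → Finset ℝ) (r q s : ℝ) : Prop :=
  ∃ C : ℝ, ∀ j : ℕ, 1 ≤ j → ∀ f : 𝓢(Space d, ℂ),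
    eLpNorm (fun x : Space d => (∑ t ∈ Ej j, ‖halfWaveLoc φ j (-t) (⇑f) x‖ ^ r) ^ (1 / r))
        (ENNReal.ofReal q) volume
      ≤ ENNReal.ofReal (C * (2 : ℝ) ^ ((j : ℝ) * s)) * eLpNorm (⇑f) 2 volume

end FractalWave

end

/-! The lower bound comes from testing on one focusing wave packet. Write d = n + 1, R = 2^j and a =
Mℓ, where ℓ = |I| and M is a large constant. The packet starts near a cap of the sphere |x| = t₀, of
thickness about 1/R and angular width about (Ra)^(-1/2), with height R^(n/2). For every t with |t -
t₀| ≤ 3ℓ the propagated packet has height at least a constant times (R/a)^(n/2) on a box of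
dimensions 1/R and (a/R)^(1/2) around its moving center. The discretization contains at least N(E ∩
I, 2^{-j})/2 such times. Dividing by the `L^p` size of the packet gives exactly the claimed powers
of R and ℓ (`packet_ratio_eq`).

Stationary phase is avoided by an exact choice of the packet. In the coordinates l = |ξ| + ξ₁ and y
= (ξ₂, …, ξ_d), both ξ₁ and |ξ| are combinations of l and |y|²/l, and dξ₁ = (|ξ|/l) dl. The factors
of `packetHat` are chosen so that the amplitude becomes a bump in l/R times e^{-a|y|²/(2l)}. At time
zero the y-integral is then an explicit complex Gaussian integral, and a Laplace–Fourier integral of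
a bump remains (`integral_packetHat_eq`). This yields uniform bounds in `L^∞` and `L^1`, hence in
every `L^p` (`exists_packet`). Near the focusing time the whole symbol, phases included, is almost
constant against the Gaussian, so nothing cancels (`packet_integral_lower`, `norm_symbol_sub_le`,
`exists_packet_lower`). Only boundedness, continuity and a Lipschitz bound at a point where ψ does
not vanish are asked of the frequency cutoff ψ, so ψ = φ and ψ = 1 are treated together
(`lowerQuantity_le_opNorm`).

For (ii), a smoothing estimate with exponent s bounds ℓ^{-α} N(E ∩ I, 2^{-j}) by a power of 2^j
uniformly in I, which bounds the Legendre–Assouad function and gives `criticalExponent` ≤ s. For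
(iii), complex conjugation reverses time and ℓ^r embeds in ℓ^q, so a square function estimate
implies a smoothing estimate with p = 2. -/

noncomputable section

namespace FractalWave


/-! ### A Schwartz function supported in a light-cone slab -/

/-- Real powers of exponent at most one have temperate growth away from the origin. -/
theorem rpow_comp_hasTemperateGrowth {H : Type*} [NormedAddCommGroup H] [NormedSpace ℝ H]
    {r : ℝ} (hr : r ≤ 1) {f : H → ℝ} (hf : f.HasTemperateGrowth) (hpos : ∀ x, 1 / 2 < f x) :
    (fun x => f x ^ r).HasTemperateGrowth := by
  set t := {y : ℝ | 1 / 2 < y}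
  have ht : Set.range f ⊆ t := by
    rintro - ⟨y, rfl⟩
    exact hpos y
  have hdiff : ContDiffOn ℝ ∞ (fun x : ℝ ↦ x ^ r) t :=
    contDiffOn_fun_id.rpow_const_of_ne fun x hx ↦ (lt_trans (by norm_num) hx).ne'
  have hunique : UniqueDiffOn ℝ t := (isOpen_lt' (1 / 2)).uniqueDiffOn
  apply Function.HasTemperateGrowth.comp' ht hunique hdiff _ hf
  intro N
  -- The n-th derivative of x^r is a constant times x^(r-n). For x ≥ 1 it grows at most linearly
  -- since r - n ≤ 1; for 1/2 < x < 1 the power is at most 2^(N+|r|).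
  refine ⟨1, (∑ k ∈ Finset.range (N + 1), ‖Polynomial.eval r (descPochhammer ℝ k)‖) *
    2 ^ ((N : ℝ) + |r|), by positivity, ?_⟩
  intro n hn x hx
  have hx2 : 1 / 2 < x := hx
  have : ContDiffAt ℝ n (fun x : ℝ ↦ x ^ r) x :=
    Real.contDiffAt_rpow_const <| Or.inl (lt_trans (by norm_num) hx2).ne'
  rw [norm_iteratedFDerivWithin_eq_norm_iteratedDerivWithin,
    iteratedDerivWithin_eq_iteratedDeriv hunique this hx, iteratedDeriv_eq_iterate,
    Real.iter_deriv_rpow_const, norm_mul, mul_assoc]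
  have hx0 : 0 < x := by linarith
  have hnN : (n : ℝ) ≤ N := by exact_mod_cast hn
  gcongr 1
  · have : n ∈ Finset.range (N + 1) := by grind
    apply Finset.single_le_sum (f := fun k => ‖Polynomial.eval r (descPochhammer ℝ k)‖)
      (fun _ _ ↦ by positivity) this
  · rw [Real.norm_of_nonneg (by positivity), Real.norm_of_nonneg hx0.le, pow_one]
    rcases le_or_gt 1 x with h1 | h1
    · calc x ^ (r - n) ≤ x ^ (1 : ℝ) := Real.rpow_le_rpow_of_exponent_le h1 (by
            have : (0 : ℝ) ≤ n := by positivity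
            linarith)
        _ = 1 * x := by rw [Real.rpow_one, one_mul]
        _ ≤ 2 ^ ((N : ℝ) + |r|) * (1 + x) := by
          gcongr
          · exact Real.one_le_rpow (by norm_num) (by positivity)
          · linarith
    · calc x ^ (r - n) ≤ x ^ (-((N : ℝ) + |r|)) :=
            Real.rpow_le_rpow_of_exponent_ge hx0 h1.le (by linarith [neg_abs_le r])
        _ ≤ (1 / 2 : ℝ) ^ (-((N : ℝ) + |r|)) :=
            Real.rpow_le_rpow_of_nonpos (by norm_num) hx2.le (by
              have := abs_nonneg r
              have : (0 : ℝ) ≤ N := by positivity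
              linarith)
        _ = 2 ^ ((N : ℝ) + |r|) * 1 := by
          rw [Real.rpow_neg (by norm_num), one_div, Real.inv_rpow (by norm_num), inv_inv, mul_one]
        _ ≤ _ := by gcongr; linarith

/-- Smooth functions on the line that vanish on the negative axis and are eventually constant. -/
def IsSmoothStep (b : ℝ → ℂ) : Prop :=
  ContDiff ℝ ∞ b ∧ (∀ y < 0, b y = 0) ∧ ∃ c, ∀ y > 1, b y = c

theorem IsSmoothStep.bounded {b : ℝ → ℂ} (hb : IsSmoothStep b) : ∃ C, ∀ y, ‖b y‖ ≤ C := by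
  obtain ⟨h1, h2, c, h3⟩ := hb
  obtain ⟨C, hC⟩ := isCompact_Icc.exists_bound_of_continuousOn
    (h1.continuous.continuousOn (s := Icc (0 : ℝ) 1))
  refine ⟨max C ‖c‖, fun y => ?_⟩
  rcases lt_or_ge y 0 with h | h
  · rw [h2 y h]; simp
  · rcases lt_or_ge 1 y with h' | h'
    · rw [h3 y h']; simp
    · exact (hC y ⟨h, h'⟩).trans (le_max_left _ _)

theorem IsSmoothStep.isSmoothStep_deriv {b : ℝ → ℂ} (hb : IsSmoothStep b) : IsSmoothStep (deriv b) := by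
  obtain ⟨h1, h2, c, h3⟩ := hb
  refine ⟨(contDiff_infty_iff_deriv.1 h1).2, fun y hy => ?_, 0, fun y hy => ?_⟩
  · have : b =ᶠ[𝓝 y] fun _ => 0 := by
      filter_upwards [Iio_mem_nhds hy] with x hx using h2 x hx
    rw [this.deriv_eq, deriv_const]
  · have : b =ᶠ[𝓝 y] fun _ => c := by
      filter_upwards [Ioi_mem_nhds hy] with x hx using h3 x hx
    rw [this.deriv_eq, deriv_const]

theorem IsSmoothStep.sub_const_mul {b b' : ℝ → ℂ} (hb : IsSmoothStep b) (hb' : IsSmoothStep b')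
    (z : ℂ) : IsSmoothStep (fun y => b' y - z * b y) := by
  obtain ⟨h1, h2, c, h3⟩ := hb
  obtain ⟨h1', h2', c', h3'⟩ := hb'
  refine ⟨h1'.sub (contDiff_const.mul h1), fun y hy => ?_, c' - z * c, fun y hy => ?_⟩
  · simp [h2 y hy, h2' y hy]
  · simp [h3 y hy, h3' y hy]

/-- The derivative of b e^{-zy} is (b' - zb) e^{-zy}, and b' - zb is again a smooth step. Hence the
induction on m runs over all b at once and only the undifferentiated case needs an estimate. -/
theorem IsSmoothStep.decay {z : ℂ} (hz : 0 < z.re) (k m : ℕ) :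
    ∀ {b : ℝ → ℂ}, IsSmoothStep b → ∃ C, ∀ y : ℝ,
      ‖y‖ ^ k * ‖iteratedDeriv m (fun y : ℝ => b y * Complex.exp (-z * y)) y‖ ≤ C := by
  induction m with
  | zero =>
    intro b hb
    obtain ⟨C, hC⟩ := hb.bounded
    have hC0 : 0 ≤ C := (norm_nonneg _).trans (hC 0)
    refine ⟨C * ((k.factorial : ℝ) / z.re ^ k), fun y => ?_⟩
    rw [iteratedDeriv_zero, norm_mul, Complex.norm_exp]
    rcases lt_or_ge y 0 with h | h
    · rw [hb.2.1 y h]; simp; positivity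
    · have hre : (-z * (y : ℂ)).re = -(z.re * y) := by simp
      have h1 := Real.pow_div_factorial_le_exp (z.re * y) (by positivity) k
      rw [hre, Real.norm_of_nonneg h, Real.exp_neg]
      have h2 : y ^ k * (Real.exp (z.re * y))⁻¹ ≤ (k.factorial : ℝ) / z.re ^ k := by
        rw [← div_eq_mul_inv, div_le_div_iff₀ (Real.exp_pos _) (by positivity)]
        rw [div_le_iff₀ (by positivity), mul_pow] at h1
        linarith
      calc y ^ k * (‖b y‖ * (Real.exp (z.re * y))⁻¹)
          = ‖b y‖ * (y ^ k * (Real.exp (z.re * y))⁻¹) := by ring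
        _ ≤ _ := by gcongr; exact hC y
  | succ m ih =>
    intro b hb
    have hd : deriv (fun y : ℝ => b y * Complex.exp (-z * y)) =
        fun y : ℝ => (deriv b y - z * b y) * Complex.exp (-z * y) := by
      funext y
      have h1 : HasDerivAt b (deriv b y) y :=
        (hb.1.differentiable (by simp)).differentiableAt.hasDerivAt
      have h2 : HasDerivAt (fun y : ℝ => Complex.exp (-z * y)) (Complex.exp (-z * y) * (-z * 1)) y :=
        ((Complex.ofRealCLM.hasDerivAt (x := y)).const_mul (-z)).cexp
      rw [(h1.fun_mul h2).deriv]
      ring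
    obtain ⟨C, hC⟩ := ih (hb.sub_const_mul hb.isSmoothStep_deriv z)
    refine ⟨C, fun y => ?_⟩
    rw [iteratedDeriv_succ', hd]
    exact hC y

/-- A Schwartz function on the line which agrees with `e^{-zy}` for `y > 1`. -/
theorem exists_schwartz_eq_exp {z : ℂ} (hz : 0 < z.re) :
    ∃ S : 𝓢(ℝ, ℂ), ∀ y : ℝ, 1 < y → S y = Complex.exp (-z * y) := by
  have hb : IsSmoothStep (fun y => (Real.smoothTransition y : ℂ)) := by
    refine ⟨Complex.ofRealCLM.contDiff.comp Real.smoothTransition.contDiff, fun y hy => ?_, 1,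
      fun y hy => ?_⟩
    · simp [Real.smoothTransition.zero_of_nonpos hy.le]
    · simp [Real.smoothTransition.one_of_one_le hy.le]
  refine ⟨⟨fun y => (Real.smoothTransition y : ℂ) * Complex.exp (-z * y), ?_, ?_⟩, ?_⟩
  · exact hb.1.mul ((contDiff_const.mul Complex.ofRealCLM.contDiff).cexp)
  · intro k m
    obtain ⟨C, hC⟩ := IsSmoothStep.decay hz k m hb
    refine ⟨C, fun y => ?_⟩
    rw [norm_iteratedFDeriv_eq_norm_iteratedDeriv]
    exact hC y
  · intro y hy
    change (Real.smoothTransition y : ℂ) * Complex.exp (-z * y) = _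
    simp [Real.smoothTransition.one_of_one_le hy.le]

/-- For `K` smooth with compact support in `(0, ∞)` and a continuous linear functional `L` of norm
at most one, `K(|ξ| + L ξ) |ξ|⁻¹ e^{-z|ξ|}` is a Schwartz function. -/
theorem exists_schwartz_lightcone {H : Type*} [NormedAddCommGroup H] [InnerProductSpace ℝ H]
    [FiniteDimensional ℝ H]
    {z : ℂ} (hz : 0 < z.re) {K : ℝ → ℂ} (hK : ContDiff ℝ ∞ K) (hKc : HasCompactSupport K)
    {l : ℝ} (hl : 0 < l) (hKl : ∀ y ≤ l, K y = 0) (L : H →L[ℝ] ℝ) (hL : ∀ x, L x ≤ ‖x‖) :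
    ∃ G : 𝓢(H, ℂ), ∀ ξ, G ξ = K (‖ξ‖ + L ξ) * (‖ξ‖⁻¹ : ℝ) * Complex.exp (-z * ‖ξ‖) := by
  -- The norm is not smooth at the origin, so |ξ|/c is replaced by a smooth N that equals it for |ξ|
  -- ≥ c. For |ξ| < c both arguments of K stay below l, because cN + Lξ ≤ 3c < 4c = l, so the
  -- replacement is invisible.
  set c : ℝ := l / 4 with hc
  have hc0 : 0 < c := by positivity
  let β : ContDiffBump (0 : H) := ⟨3 / 4, 1, by norm_num, by norm_num⟩
  let q : H → ℝ := fun ξ => ‖c⁻¹ • ξ‖ ^ 2 + β (c⁻¹ • ξ)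
  have hscale : (fun ξ : H => c⁻¹ • ξ).HasTemperateGrowth :=
    (c⁻¹ • ContinuousLinearMap.id ℝ H).hasTemperateGrowth
  have hq : q.HasTemperateGrowth := by
    refine Function.HasTemperateGrowth.comp (g := fun x : H => ‖x‖ ^ 2 + β x) ?_ hscale
    exact (Function.hasTemperateGrowth_norm_sq H).add
      (β.hasCompactSupport.hasTemperateGrowth β.contDiff)
  have hq2 : ∀ ξ, 1 / 2 < q ξ := by
    intro ξ
    have h0 := β.nonneg (x := c⁻¹ • ξ)
    by_cases h : ‖c⁻¹ • ξ‖ ≤ 3 / 4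
    · have : β (c⁻¹ • ξ) = 1 := β.one_of_mem_closedBall (by simpa using h)
      simp only [q, this]
      nlinarith [norm_nonneg (c⁻¹ • ξ)]
    · simp only [q]
      push Not at h
      nlinarith
  have hqbig : ∀ ξ, c ≤ ‖ξ‖ → q ξ = (‖ξ‖ / c) ^ 2 := by
    intro ξ h
    have hn : ‖c⁻¹ • ξ‖ = ‖ξ‖ / c := by
      rw [norm_smul, Real.norm_of_nonneg (by positivity)]; field_simp
    have : β (c⁻¹ • ξ) = 0 := β.zero_of_le_dist (by
      rw [dist_zero_right, hn]; change (1 : ℝ) ≤ _; rw [le_div_iff₀ hc0]; linarith)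
    simp only [q, this, hn, add_zero]
  have hqsmall : ∀ ξ, ‖ξ‖ < c → q ξ ≤ 2 := by
    intro ξ h
    have hn : ‖c⁻¹ • ξ‖ = ‖ξ‖ / c := by
      rw [norm_smul, Real.norm_of_nonneg (by positivity)]; field_simp
    have h1 : ‖ξ‖ / c ≤ 1 := by rw [div_le_one hc0]; exact h.le
    have h2 : 0 ≤ ‖ξ‖ / c := by positivity
    have := β.le_one (x := c⁻¹ • ξ)
    simp only [q, hn]
    nlinarith
  have hqge : ∀ ξ, (‖ξ‖ / c) ^ 2 ≤ q ξ := by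
    intro ξ
    have hn : ‖c⁻¹ • ξ‖ = ‖ξ‖ / c := by
      rw [norm_smul, Real.norm_of_nonneg (by positivity)]; field_simp
    have := β.nonneg (x := c⁻¹ • ξ)
    simp only [q, hn]; linarith
  let N : H → ℝ := fun ξ => q ξ ^ (1 / 2 : ℝ)
  have hN : N.HasTemperateGrowth := rpow_comp_hasTemperateGrowth (by norm_num) hq hq2
  have hNi : (fun ξ => q ξ ^ (-(1 / 2) : ℝ)).HasTemperateGrowth :=
    rpow_comp_hasTemperateGrowth (by norm_num) hq hq2
  have hNbig : ∀ ξ, c ≤ ‖ξ‖ → N ξ = ‖ξ‖ / c := by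
    intro ξ h
    simp only [N, hqbig ξ h]
    rw [← Real.sqrt_eq_rpow, Real.sqrt_sq (by positivity)]
  have hNge : ∀ ξ, ‖ξ‖ / c ≤ N ξ := by
    intro ξ
    simp only [N]
    rw [← Real.sqrt_eq_rpow]
    exact Real.le_sqrt_of_sq_le (hqge ξ)
  have hNsmall : ∀ ξ, ‖ξ‖ < c → N ξ ≤ 2 := by
    intro ξ h
    simp only [N]
    rw [← Real.sqrt_eq_rpow, Real.sqrt_le_iff]
    exact ⟨by norm_num, by linarith [hqsmall ξ h]⟩
  have hN2 : ∀ ξ, 1 / 2 < N ξ := by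
    intro ξ
    simp only [N]
    rw [← Real.sqrt_eq_rpow]
    exact Real.lt_sqrt_of_sq_lt (by linarith [hq2 ξ])
  -- S is an exponential only beyond 1 while N is only known to exceed 1/2, so S is evaluated at 2N;
  -- the rate c/2 · z compensates.
  obtain ⟨S, hS⟩ := exists_schwartz_eq_exp (z := c / 2 * z)
    (by have : ((c : ℂ) / 2 * z).re = c / 2 * z.re := by
          rw [show (c : ℂ) / 2 = ((c / 2 : ℝ) : ℂ) by push_cast; rfl, Complex.re_ofReal_mul]
        rw [this]; positivity)
  have h2N : (fun ξ => 2 * N ξ).HasTemperateGrowth :=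
    (Function.HasTemperateGrowth.const (2 : ℝ)).mul hN
  have hup : ∃ (k : ℕ) (C : ℝ), ∀ x, ‖x‖ ≤ C * (1 + ‖2 * N x‖) ^ k := by
    refine ⟨1, c, fun x => ?_⟩
    rw [pow_one, Real.norm_of_nonneg (by linarith [hN2 x])]
    have := hNge x
    rw [div_le_iff₀ hc0] at this
    nlinarith [hN2 x]
  have hKt : (fun ξ => K (c * N ξ + L ξ)).HasTemperateGrowth :=
    (hKc.hasTemperateGrowth hK).comp
      (((Function.HasTemperateGrowth.const c).mul hN).add L.hasTemperateGrowth)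
  have hit : (fun ξ => ((c⁻¹ * q ξ ^ (-(1 / 2) : ℝ) : ℝ) : ℂ)).HasTemperateGrowth :=
    Function.HasTemperateGrowth.comp Function.Complex.hasTemperateGrowth_ofReal ((Function.HasTemperateGrowth.const c⁻¹).mul hNi)
  have hprod : (fun ξ => K (c * N ξ + L ξ) *
      ((c⁻¹ * q ξ ^ (-(1 / 2) : ℝ) : ℝ) : ℂ)).HasTemperateGrowth := hKt.mul hit
  refine ⟨SchwartzMap.smulLeftCLM ℂ (fun ξ => K (c * N ξ + L ξ) *
    ((c⁻¹ * q ξ ^ (-(1 / 2) : ℝ) : ℝ) : ℂ)) (SchwartzMap.compCLM ℂ h2N hup S), fun ξ => ?_⟩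
  rw [SchwartzMap.smulLeftCLM_apply_apply hprod]
  simp only [SchwartzMap.compCLM_apply, Function.comp, smul_eq_mul]
  rcases lt_or_ge ‖ξ‖ c with h | h
  · have h1 : K (c * N ξ + L ξ) = 0 := hKl _ (by nlinarith [hNsmall ξ h, hL ξ])
    have h2 : K (‖ξ‖ + L ξ) = 0 := hKl _ (by nlinarith [hL ξ])
    rw [h1, h2]; simp
  · have h1 : c * N ξ = ‖ξ‖ := by rw [hNbig ξ h]; field_simp
    have h2 : c⁻¹ * q ξ ^ (-(1 / 2) : ℝ) = ‖ξ‖⁻¹ := by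
      rw [Real.rpow_neg (by linarith [hq2 ξ])]
      change c⁻¹ * (N ξ)⁻¹ = _
      rw [← mul_inv, h1]
    rw [h1, h2, hS _ (by linarith [hN2 ξ])]
    congr 2
    rw [hNbig ξ h]
    push_cast
    have : (c : ℂ) ≠ 0 := by exact_mod_cast hc0.ne'
    field_simp


/-! ### Fourier inversion -/

/-- Every Schwartz function is the Fourier transform of a Schwartz function. -/
theorem exists_fourierHat_eq {d : ℕ} (G : 𝓢(Space d, ℂ)) :
    ∃ f : 𝓢(Space d, ℂ), (∀ ξ, fourierHat f ξ = G ξ) ∧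
      ∀ x, f x = ((((2 * Real.pi) ^ d)⁻¹ : ℝ) : ℂ) *
        ∫ ξ : Space d, G ξ * Complex.exp (Complex.I * ((inner ℝ x ξ : ℝ) : ℂ)) := by
  have hpi : (2 * Real.pi : ℝ) ≠ 0 := by positivity
  let e : Space d ≃L[ℝ] Space d :=
    ContinuousLinearEquiv.smulLeft (Units.mk0 (2 * Real.pi) hpi)
  have he : ∀ x, e x = (2 * Real.pi) • x := fun x => rfl
  let G' : 𝓢(Space d, ℂ) := SchwartzMap.compCLMOfContinuousLinearEquiv ℂ e G
  have hG' : ∀ x, G' x = G ((2 * Real.pi) • x) := fun x => rfl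
  refine ⟨FourierTransform.fourierInv G', fun ξ => ?_, fun x => ?_⟩
  · have h : FourierTransform.fourier (FourierTransform.fourierInv G') = G' :=
      FourierTransform.fourier_fourierInv_eq G'
    have h2 := congrArg (fun g : 𝓢(Space d, ℂ) => g ((2 * Real.pi)⁻¹ • ξ)) h
    simp only [hG', smul_smul, mul_inv_cancel₀ hpi, one_smul] at h2
    rw [← h2, SchwartzMap.fourier_coe, Real.fourier_eq']
    unfold fourierHat
    congr 1
    funext y
    rw [smul_eq_mul, mul_comm, inner_smul_right]
    congr 2
    push_cast
    field_simp
  · rw [SchwartzMap.fourierInv_coe, Real.fourierInv_eq']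
    have := Measure.integral_comp_smul (volume : Measure (Space d))
      (fun ξ => G ξ * Complex.exp (Complex.I * ((inner ℝ x ξ : ℝ) : ℂ))) (2 * Real.pi)
    rw [finrank_euclideanSpace_fin, abs_of_nonneg (by positivity), Complex.real_smul] at this
    rw [← this]
    congr 1
    funext y
    rw [smul_eq_mul, mul_comm, hG', inner_smul_right, real_inner_comm]
    congr 2
    push_cast
    ring

/-! ### Splitting off the first coordinate -/

/-- The point of `ℝ^{n+1}` with first coordinate `s` and remaining coordinates `y`. -/
def glue {n : ℕ} (s : ℝ) (y : Space n) : Space (n + 1) :=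
  WithLp.toLp 2 (Fin.cons s y.ofLp)

/-- The last `n` coordinates of a point of `ℝ^{n+1}`. -/
def transverse {n : ℕ} (x : Space (n + 1)) : Space n := WithLp.toLp 2 fun i => x i.succ

@[simp] theorem glue_zero {n : ℕ} (s : ℝ) (y : Space n) : glue s y 0 = s := rfl

@[simp] theorem transverse_glue {n : ℕ} (s : ℝ) (y : Space n) : transverse (glue s y) = y := rfl

theorem inner_eq {n : ℕ} (x y : Space (n + 1)) :
    inner ℝ x y = x 0 * y 0 + inner ℝ (transverse x) (transverse y) := by
  simp [PiLp.inner_apply, Fin.sum_univ_succ, transverse, mul_comm]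

theorem norm_sq_eq {n : ℕ} (x : Space (n + 1)) :
    ‖x‖ ^ 2 = x 0 ^ 2 + ‖transverse x‖ ^ 2 := by
  rw [← real_inner_self_eq_norm_sq, inner_eq, real_inner_self_eq_norm_sq]; ring

/-- The splitting `ℝ^{n+1} ≃ ℝ × ℝ^n` -/
def splitEquiv (n : ℕ) : Space (n + 1) ≃ᵐ ℝ × Space n :=
  ((MeasurableEquiv.toLp 2 (Fin (n + 1) → ℝ)).symm.trans
    (MeasurableEquiv.piFinSuccAbove (fun _ => ℝ) 0)).trans
    ((MeasurableEquiv.refl ℝ).prodCongr (MeasurableEquiv.toLp 2 (Fin n → ℝ)))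

theorem splitEquiv_apply {n : ℕ} (x : Space (n + 1)) : splitEquiv n x = (x 0, transverse x) := rfl

theorem splitEquiv_symm_apply {n : ℕ} (w : ℝ × Space n) :
    (splitEquiv n).symm w = glue w.1 w.2 := by
  rw [MeasurableEquiv.symm_apply_eq, splitEquiv_apply]
  simp

theorem measurePreserving_splitEquiv (n : ℕ) : MeasurePreserving (splitEquiv n) := by
  have h1 := EuclideanSpace.volume_preserving_symm_measurableEquiv_toLp (Fin (n + 1))
  have h2 := volume_preserving_piFinSuccAbove (fun _ : Fin (n + 1) => ℝ) 0
  have h3 : MeasurePreserving (MeasurableEquiv.toLp 2 (Fin n → ℝ)) :=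
    (EuclideanSpace.volume_preserving_symm_measurableEquiv_toLp (Fin n)).symm
  have h4 : MeasurePreserving ((MeasurableEquiv.refl ℝ).prodCongr
      (MeasurableEquiv.toLp 2 (Fin n → ℝ))) :=
    (MeasurePreserving.id (volume : Measure ℝ)).prod h3
  exact (h1.trans h2).trans h4

theorem measurable_glue {n : ℕ} : Measurable fun w : ℝ × Space n => glue w.1 w.2 := by
  have := (splitEquiv n).symm.measurable
  rwa [show ⇑(splitEquiv n).symm = fun w : ℝ × Space n => glue w.1 w.2 from
    funext splitEquiv_symm_apply] at this

theorem lintegral_glue {n : ℕ} (h : Space (n + 1) → ℝ≥0∞) :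
    ∫⁻ x, h x = ∫⁻ w : ℝ × Space n, h (glue w.1 w.2) := by
  rw [← (measurePreserving_splitEquiv n).symm.lintegral_comp_emb
    (splitEquiv n).symm.measurableEmbedding]
  simp only [splitEquiv_symm_apply]

theorem integral_glue {n : ℕ} (h : Space (n + 1) → ℂ) :
    ∫ x, h x = ∫ w : ℝ × Space n, h (glue w.1 w.2) := by
  rw [← (measurePreserving_splitEquiv n).symm.integral_comp
    (splitEquiv n).symm.measurableEmbedding]
  simp only [splitEquiv_symm_apply]

theorem integrable_glue {n : ℕ} {h : Space (n + 1) → ℂ} (hh : Integrable h) :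
    Integrable fun w : ℝ × Space n => h (glue w.1 w.2) := by
  have := ((measurePreserving_splitEquiv n).symm.integrable_comp_emb
    (splitEquiv n).symm.measurableEmbedding (g := h)).2 hh
  simpa [Function.comp_def, splitEquiv_symm_apply] using this

/-! ### Light-cone coordinates -/

/-- The frequency with light-cone coordinate `|ξ| + ξ₁ = l` and transverse part `y`. -/
def lightcone {n : ℕ} (l : ℝ) (y : Space n) : Space (n + 1) := glue ((l - ‖y‖ ^ 2 / l) / 2) y

theorem norm_lightcone {n : ℕ} {l : ℝ} (hl : 0 < l) (y : Space n) :
    ‖lightcone l y‖ = (l + ‖y‖ ^ 2 / l) / 2 := by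
  rw [← sq_eq_sq₀ (norm_nonneg _) (by positivity), norm_sq_eq]
  simp only [lightcone, glue_zero, transverse_glue]
  field_simp
  ring

theorem norm_add_lightcone_zero {n : ℕ} {l : ℝ} (hl : 0 < l) (y : Space n) :
    ‖lightcone l y‖ + lightcone l y 0 = l := by
  rw [norm_lightcone hl]; simp only [lightcone, glue_zero]; ring

theorem abs_coord_zero_le_norm {n : ℕ} (x : Space (n + 1)) : |x 0| ≤ ‖x‖ := by
  refine abs_le_of_sq_le_sq ?_ (norm_nonneg _)
  rw [norm_sq_eq]; nlinarith [sq_nonneg ‖transverse x‖]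

/-- Substitution s = (l - |y|²/l)/2, injective on l > 0 with derivative |ξ|/l. It can only miss
points with |ξ| + ξ₁ = 0 (the half-line s ≤ 0 when y = 0), where h vanishes by assumption. -/
theorem lightcone_fiber_integral {n : ℕ} (y : Space n) (h : Space (n + 1) → ℂ)
    (h0 : ∀ ξ, ‖ξ‖ + ξ 0 = 0 → h ξ = 0) :
    ∫ s : ℝ, h (glue s y) =
      ∫ l in Ioi (0 : ℝ), ((‖lightcone l y‖ / l : ℝ) : ℂ) * h (lightcone l y) := by
  let g : ℝ → ℝ := fun l => (l - ‖y‖ ^ 2 / l) / 2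
  have hder : ∀ l ∈ Ioi (0 : ℝ), HasDerivWithinAt g ((1 + ‖y‖ ^ 2 / l ^ 2) / 2) (Ioi 0) l := by
    intro l hl
    have hl' : (l : ℝ) ≠ 0 := (ne_of_gt hl)
    have := (((hasDerivAt_id l).sub (((hasDerivAt_inv hl').const_mul (‖y‖ ^ 2)))).div_const 2)
    refine (this.congr_deriv ?_).hasDerivWithinAt.congr_of_mem (fun x _ => ?_) hl
    · field_simp; ring
    · simp [g, div_eq_mul_inv]
  have hinj : InjOn g (Ioi 0) := by
    intro l hl m hm hlm
    have h1 := norm_add_lightcone_zero hl y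
    have h2 := norm_add_lightcone_zero hm y
    have : lightcone l y = lightcone m y := by
      change glue (g l) y = glue (g m) y
      rw [hlm]
    rw [this] at h1
    linarith
  have hzero : ∀ s, s ∉ g '' Ioi 0 → h (glue s y) = 0 := by
    intro s hs
    apply h0
    by_contra hne
    apply hs
    have hpos : 0 < ‖glue s y‖ + glue s y 0 :=
      lt_of_le_of_ne (by linarith [neg_abs_le (glue s y 0), abs_coord_zero_le_norm (glue s y)])
        (Ne.symm hne)
    refine ⟨_, hpos, ?_⟩
    have hsq := norm_sq_eq (glue s y)
    simp only [g, glue_zero, transverse_glue] at hpos hsq ⊢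
    field_simp
    nlinarith
  rw [← setIntegral_eq_integral_of_forall_compl_eq_zero hzero,
    integral_image_eq_integral_abs_deriv_smul measurableSet_Ioi hder hinj]
  refine setIntegral_congr_fun measurableSet_Ioi fun l hl => ?_
  have hl' : (0 : ℝ) < l := hl
  rw [Complex.real_smul, norm_lightcone hl', abs_of_nonneg (by positivity)]
  change _ * h (lightcone l y) = _
  congr 2
  field_simp


/-! ### Decay of Laplace–Fourier transforms of bump functions -/

theorem hasCompactSupport_of_eq_zero {κ : ℝ → ℂ} {l₀ l₁ : ℝ}
    (h0 : ∀ s, s ∉ Icc l₀ l₁ → κ s = 0) : HasCompactSupport κ :=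
  HasCompactSupport.intro isCompact_Icc h0

/-- Each integration by parts trades a factor iw for a derivative of κ, with the same support. On
that support |e^{isw}| = e^{-s Im w} ≤ e^{-l₀ Im w}. -/
theorem pow_mul_norm_laplace_le {l₀ l₁ : ℝ} (N : ℕ) : ∀ {κ : ℝ → ℂ}, ContDiff ℝ ∞ κ →
    (∀ s, s ∉ Icc l₀ l₁ → κ s = 0) → ∃ C, 0 ≤ C ∧ ∀ w : ℂ, 0 ≤ w.im →
      ‖w‖ ^ N * ‖∫ s : ℝ, κ s * Complex.exp (Complex.I * s * w)‖ ≤ C * Real.exp (-(l₀ * w.im)) := by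
  induction N with
  | zero =>
    intro κ hκ h0
    have hInt : Integrable κ :=
      hκ.continuous.integrable_of_hasCompactSupport (hasCompactSupport_of_eq_zero h0)
    refine ⟨∫ s, ‖κ s‖, integral_nonneg fun _ => norm_nonneg _, fun w hw => ?_⟩
    rw [pow_zero, one_mul, ← integral_mul_const]
    refine norm_integral_le_of_norm_le (hInt.norm.mul_const _) (Eventually.of_forall fun s => ?_)
    rw [norm_mul, Complex.norm_exp]
    by_cases hs : s ∈ Icc l₀ l₁
    · gcongr
      have : (Complex.I * s * w).re = -(s * w.im) := by simp
      rw [this]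
      nlinarith [hs.1]
    · simp [h0 s hs]
  | succ N ih =>
    intro κ hκ h0
    have hκ' : ContDiff ℝ ∞ (deriv κ) := (contDiff_infty_iff_deriv.1 hκ).2
    have h0' : ∀ s, s ∉ Icc l₀ l₁ → deriv κ s = 0 := by
      intro s hs
      have : κ =ᶠ[𝓝 s] fun _ => 0 := by
        filter_upwards [isClosed_Icc.isOpen_compl.mem_nhds hs] with x hx using h0 x hx
      rw [this.deriv_eq, deriv_const]
    obtain ⟨C, hC0, hC⟩ := ih hκ' h0'
    refine ⟨C, hC0, fun w hw => ?_⟩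
    have hd : ∀ s : ℝ, HasDerivAt (fun s : ℝ => Complex.exp (Complex.I * s * w))
        (Complex.exp (Complex.I * s * w) * (Complex.I * w)) s := by
      intro s
      have h1 : HasDerivAt (fun s : ℝ => Complex.I * (s : ℂ) * w) (Complex.I * 1 * w) s :=
        ((Complex.ofRealCLM.hasDerivAt (x := s)).const_mul Complex.I).mul_const w
      simpa using h1.cexp
    have hcont : Continuous fun s : ℝ => Complex.exp (Complex.I * s * w) := by fun_prop
    have hcs := hasCompactSupport_of_eq_zero h0
    have hcs' := hasCompactSupport_of_eq_zero h0'
    have key := integral_mul_deriv_eq_deriv_mul_of_integrable (u := κ) (u' := deriv κ)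
      (v := fun s : ℝ => Complex.exp (Complex.I * s * w))
      (v' := fun s : ℝ => Complex.exp (Complex.I * s * w) * (Complex.I * w))
      (fun s _ => (hκ.differentiable (by simp)).differentiableAt.hasDerivAt) (fun s _ => hd s)
      ((hκ.continuous.mul (hcont.mul continuous_const)).integrable_of_hasCompactSupport
        hcs.mul_right)
      ((hκ'.continuous.mul hcont).integrable_of_hasCompactSupport hcs'.mul_right)
      ((hκ.continuous.mul hcont).integrable_of_hasCompactSupport hcs.mul_right)
    have h2 : (Complex.I * w) * ∫ s : ℝ, κ s * Complex.exp (Complex.I * s * w) =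
        -∫ s : ℝ, deriv κ s * Complex.exp (Complex.I * s * w) := by
      rw [← key, ← integral_const_mul]
      congr 1
      funext s
      ring
    have h3 := congrArg norm h2
    rw [norm_mul, norm_mul, Complex.norm_I, one_mul, norm_neg] at h3
    rw [pow_succ, mul_assoc, h3]
    exact hC w hw

theorem norm_laplace_le {l₀ l₁ : ℝ} {κ : ℝ → ℂ} (hκ : ContDiff ℝ ∞ κ)
    (h0 : ∀ s, s ∉ Icc l₀ l₁ → κ s = 0) (N : ℕ) : ∃ C, 0 < C ∧ ∀ w : ℂ, 0 ≤ w.im →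
      ‖∫ s : ℝ, κ s * Complex.exp (Complex.I * s * w)‖ ≤
        C * ((1 + ‖w‖) ^ N)⁻¹ * Real.exp (-(l₀ * w.im)) := by
  obtain ⟨C, hC0, hC⟩ := pow_mul_norm_laplace_le N hκ h0
  obtain ⟨C', hC0', hC'⟩ := pow_mul_norm_laplace_le 0 hκ h0
  refine ⟨2 ^ N * (C + C' + 1), by positivity, fun w hw => ?_⟩
  have h1 := hC w hw
  have h2 := hC' w hw
  rw [pow_zero, one_mul] at h2
  set J := ‖∫ s : ℝ, κ s * Complex.exp (Complex.I * s * w)‖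
  have hJ : 0 ≤ J := norm_nonneg _
  have h3 : (1 + ‖w‖) ^ N ≤ 2 ^ N * (1 + ‖w‖ ^ N) := by
    rcases le_total ‖w‖ 1 with h | h
    · calc (1 + ‖w‖) ^ N ≤ 2 ^ N := by gcongr; linarith
        _ ≤ _ := le_mul_of_one_le_right (by positivity) (by linarith [pow_nonneg (norm_nonneg w) N])
    · calc (1 + ‖w‖) ^ N ≤ (2 * ‖w‖) ^ N := by gcongr; linarith
        _ = 2 ^ N * ‖w‖ ^ N := mul_pow _ _ _
        _ ≤ _ := by gcongr; linarith
  rw [mul_right_comm, ← div_eq_mul_inv, le_div_iff₀ (by positivity)]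
  have hexp := Real.exp_pos (-(l₀ * w.im))
  calc J * (1 + ‖w‖) ^ N ≤ J * (2 ^ N * (1 + ‖w‖ ^ N)) := by gcongr
    _ = 2 ^ N * (‖w‖ ^ N * J + J) := by ring
    _ ≤ 2 ^ N * (C * Real.exp (-(l₀ * w.im)) + C' * Real.exp (-(l₀ * w.im))) := by gcongr
    _ ≤ _ := by
      rw [mul_assoc, ← add_mul]
      gcongr ?_ * (?_ * _)
      linarith

/-! ### Focusing wave packets -/

/-- The Fourier transform `k(R⁻¹(|ξ| + ξ₁)) |ξ|⁻¹ e^{a(|ξ| + ξ₁)/2 - (a + it₀)|ξ|}` of a wave packet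
which focuses at the origin at time `t₀`. -/
def packetHat {n : ℕ} (k : ℝ → ℝ) (R a t₀ : ℝ) (ξ : Space (n + 1)) : ℂ :=
  ((k (R⁻¹ * (‖ξ‖ + ξ 0)) * Real.exp (a * (‖ξ‖ + ξ 0) / 2) : ℝ) : ℂ) * (‖ξ‖⁻¹ : ℝ) *
    Complex.exp (-(a + t₀ * Complex.I) * ‖ξ‖)

theorem exists_schwartz_packetHat {n : ℕ} {k : ℝ → ℝ} (hk : ContDiff ℝ ∞ k) {l₀ l₁ : ℝ}
    (hl₀ : 0 < l₀) (hk0 : ∀ s, s ∉ Icc l₀ l₁ → k s = 0) {R a : ℝ} (hR : 0 < R) (ha : 0 < a)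
    (t₀ : ℝ) : ∃ G : 𝓢(Space (n + 1), ℂ), ∀ ξ, G ξ = packetHat k R a t₀ ξ := by
  let K : ℝ → ℝ := fun s => k (R⁻¹ * s) * Real.exp (a * s / 2)
  have hK : ContDiff ℝ ∞ K :=
    (hk.comp (contDiff_const.mul contDiff_id)).mul
      ((contDiff_const.mul contDiff_id).div_const 2).exp
  have hK0 : ∀ s, s ∉ Icc (R * l₀) (R * l₁) → K s = 0 := by
    intro s hs
    have : k (R⁻¹ * s) = 0 := by
      apply hk0
      intro h
      apply hs
      rw [mem_Icc, inv_mul_eq_div, le_div_iff₀ hR, div_le_iff₀ hR] at h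
      constructor <;> linarith [h.1, h.2]
    simp [K, this]
  obtain ⟨G, hG⟩ := exists_schwartz_lightcone (H := Space (n + 1))
    (z := a + t₀ * Complex.I) (by simpa using ha) (K := fun s => (K s : ℂ))
    (Complex.ofRealCLM.contDiff.comp hK)
    (HasCompactSupport.intro (isCompact_Icc (a := R * l₀) (b := R * l₁))
      fun s hs => by simp [hK0 s hs])
    (l := R * l₀ / 2) (by positivity)
    (fun y hy => by
      have : K y = 0 := hK0 y fun h => by nlinarith [h.1, mul_pos hR hl₀]
      simp [this])
    (EuclideanSpace.proj (0 : Fin (n + 1)))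
    (fun x => (le_abs_self _).trans (abs_coord_zero_le_norm x))
  refine ⟨G, fun ξ => ?_⟩
  rw [hG]
  simp only [packetHat, K]
  rfl

/-- The weight `k(s)/s e^{-a|y|²/(2Rs)}` of a wave packet in light-cone coordinates. -/
def packetWeight {n : ℕ} (k : ℝ → ℝ) (R a : ℝ) (s : ℝ) (y : Space n) : ℝ :=
  k s / s * Real.exp (-(a / (2 * (R * s))) * ‖y‖ ^ 2)

/-- The Jacobian |ξ|/l cancels the factor |ξ|⁻¹, and al/2 - a|ξ| = -a|y|²/(2l) because 2|ξ| = l +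
|y|²/l. The amplitude is therefore exactly Gaussian in y. -/
theorem packetHat_lightcone {n : ℕ} (k : ℝ → ℝ) {R a t₀ l : ℝ} (hl : 0 < l) (y : Space n) :
    ((‖lightcone l y‖ / l : ℝ) : ℂ) * packetHat k R a t₀ (lightcone l y) =
      ((k (R⁻¹ * l) / l * Real.exp (-(a / (2 * l)) * ‖y‖ ^ 2) : ℝ) : ℂ) *
        Complex.exp (-(Complex.I * ((t₀ * ‖lightcone l y‖ : ℝ) : ℂ))) := by
  unfold packetHat
  rw [norm_add_lightcone_zero hl]
  have hne : ‖lightcone l y‖ ≠ 0 := by rw [norm_lightcone hl]; positivity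
  have h1 : Complex.exp (-(a + t₀ * Complex.I) * ‖lightcone l y‖) =
      (Real.exp (-(a * ‖lightcone l y‖)) : ℂ) *
        Complex.exp (-(Complex.I * ((t₀ * ‖lightcone l y‖ : ℝ) : ℂ))) := by
    rw [Complex.ofReal_exp, ← Complex.exp_add]
    congr 1
    push_cast
    ring
  have h2 : Real.exp (-(a / (2 * l)) * ‖y‖ ^ 2) =
      Real.exp (a * l / 2) * Real.exp (-(a * ‖lightcone l y‖)) := by
    rw [← Real.exp_add, norm_lightcone hl]
    congr 1
    field_simp
    ring
  rw [h1, h2]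
  have hl' : (l : ℂ) ≠ 0 := by exact_mod_cast hl.ne'
  have hne' : (‖lightcone l y‖ : ℂ) ≠ 0 := by exact_mod_cast hne
  push_cast
  field_simp

theorem measurable_lightcone {n : ℕ} :
    Measurable fun w : Space n × ℝ => lightcone w.2 w.1 := by
  unfold lightcone
  exact measurable_glue.comp (f := fun w : Space n × ℝ => ((w.2 - ‖w.1‖ ^ 2 / w.2) / 2, w.1))
    (by fun_prop)

theorem integral_gaussian {n : ℕ} {β : ℝ} (hβ : 0 < β) :
    Integrable (fun y : Space n => Real.exp (-β * ‖y‖ ^ 2)) ∧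
      ∫ y : Space n, Real.exp (-β * ‖y‖ ^ 2) = (Real.pi / β) ^ ((n : ℝ) / 2) := by
  have h := GaussianFourier.integral_rexp_neg_mul_sq_norm (V := Space n) hβ
  rw [finrank_euclideanSpace_fin] at h
  refine ⟨?_, h⟩
  -- The integral of a non-integrable function is 0 by convention, which contradicts the positive
  -- value in `h`.
  by_contra hc
  rw [integral_undef hc] at h
  have : 0 < (Real.pi / β) ^ ((n : ℝ) / 2) := by positivity
  linarith

theorem packetWeight_integrable {n : ℕ} {k : ℝ → ℝ} (hk : Continuous k) {l₀ l₁ : ℝ}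
    (hl₀ : 0 < l₀) (hk0 : ∀ s, s ∉ Icc l₀ l₁ → k s = 0) {R a : ℝ} (hR : 0 < R) (ha : 0 < a)
    {g : Space n × ℝ → ℂ} (hg : Measurable g) {B : ℝ} (hB : ∀ w, ‖g w‖ ≤ B) :
    Integrable (fun w : Space n × ℝ => (packetWeight k R a w.2 w.1 : ℂ) * g w)
      (volume.prod (volume.restrict (Ioi 0))) := by
  have hB0 : 0 ≤ B := (norm_nonneg _).trans (hB 0)
  rcases lt_or_ge l₁ l₀ with hll | hll
  · have : (fun w : Space n × ℝ => (packetWeight k R a w.2 w.1 : ℂ) * g w) = fun _ => 0 := by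
      funext w
      simp [packetWeight, hk0 w.2 (by rw [Icc_eq_empty (not_le.2 hll)]; simp)]
    rw [this]; exact integrable_zero _ _ _
  have hl₁ : 0 < l₁ := hl₀.trans_le hll
  -- The slowest Gaussian, at s = l₁, dominates all the others.
  have h1 : Integrable (fun y : Space n => Real.exp (-(a / (2 * (R * l₁))) * ‖y‖ ^ 2)) := by
    have hb : 0 < a / (2 * (R * l₁)) := by positivity
    exact (integral_gaussian hb).1
  have hcs : HasCompactSupport k := HasCompactSupport.intro isCompact_Icc hk0
  have h2 : Integrable (fun s : ℝ => |k s| / l₀ * B) (volume.restrict (Ioi 0)) :=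
    (((hk.integrable_of_hasCompactSupport hcs).abs.div_const l₀).mul_const B).restrict
  refine Integrable.mono' (h1.mul_prod h2) ?_ (Eventually.of_forall fun w => ?_)
  · apply Measurable.aestronglyMeasurable
    unfold packetWeight
    have := hk.measurable
    fun_prop
  · rw [norm_mul, Complex.norm_real, packetWeight, norm_mul, norm_div, Real.norm_eq_abs (k _),
      Real.norm_of_nonneg (Real.exp_pos _).le]
    by_cases hs : w.2 ∈ Icc l₀ l₁
    · have hw : 0 < w.2 := hl₀.trans_le hs.1
      rw [Real.norm_of_nonneg hw.le]
      calc |k w.2| / w.2 * Real.exp (-(a / (2 * (R * w.2))) * ‖w.1‖ ^ 2) * ‖g w‖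
          ≤ |k w.2| / l₀ * Real.exp (-(a / (2 * (R * l₁))) * ‖w.1‖ ^ 2) * B := by
            gcongr
            · exact hs.1
            · exact hs.2
            · exact hB w
        _ = _ := by ring
    · rw [hk0 _ hs]; simp

/-- Used twice: with m = e^{i⟨x,ξ⟩} for the packet itself, and with the full propagator symbol near
the focusing time. After l = Rs the bump k no longer depends on R. -/
theorem integral_mul_packetHat {n : ℕ} {k : ℝ → ℝ} (hk : ContDiff ℝ ∞ k) {l₀ l₁ : ℝ}
    (hl₀ : 0 < l₀) (hk0 : ∀ s, s ∉ Icc l₀ l₁ → k s = 0) {R a : ℝ} (hR : 0 < R) (ha : 0 < a)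
    (t₀ : ℝ) {m : Space (n + 1) → ℂ} (hm : Measurable m) {B : ℝ} (hB : ∀ ξ, ‖m ξ‖ ≤ B) :
    ∫ ξ, m ξ * packetHat k R a t₀ ξ =
      ∫ s in Ioi (0 : ℝ), ∫ y : Space n, (packetWeight k R a s y : ℂ) *
        (m (lightcone (R * s) y) *
          Complex.exp (-(Complex.I * ((t₀ * ‖lightcone (R * s) y‖ : ℝ) : ℂ)))) := by
  obtain ⟨G, hG⟩ := exists_schwartz_packetHat (n := n) hk hl₀ hk0 hR ha t₀
  have hInt : Integrable fun ξ : Space (n + 1) => m ξ * packetHat k R a t₀ ξ := by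
    simp_rw [← hG]
    exact G.integrable.bdd_mul hm.aestronglyMeasurable (Eventually.of_forall hB)
  have hkz : k 0 = 0 := hk0 0 fun h => absurd h.1 (not_le.2 hl₀)
  have hzero : ∀ ξ : Space (n + 1), ‖ξ‖ + ξ 0 = 0 → m ξ * packetHat k R a t₀ ξ = 0 := by
    intro ξ h
    simp [packetHat, h, hkz]
  rw [integral_glue, Measure.volume_eq_prod, integral_prod_symm _ (integrable_glue hInt)]
  have hfib : ∀ y : Space n, ∫ s : ℝ, m (glue s y) * packetHat k R a t₀ (glue s y) =
      ∫ s in Ioi (0 : ℝ), (packetWeight k R a s y : ℂ) *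
        (m (lightcone (R * s) y) *
          Complex.exp (-(Complex.I * ((t₀ * ‖lightcone (R * s) y‖ : ℝ) : ℂ)))) := by
    intro y
    rw [lightcone_fiber_integral y _ hzero]
    have hsc := integral_comp_mul_left_Ioi (fun l : ℝ => ((‖lightcone l y‖ / l : ℝ) : ℂ) *
      (m (lightcone l y) * packetHat k R a t₀ (lightcone l y))) 0 hR
    rw [mul_zero] at hsc
    rw [← inv_smul_eq_iff₀ (inv_ne_zero hR.ne'), inv_inv] at hsc
    rw [← hsc, ← integral_smul]
    refine setIntegral_congr_fun measurableSet_Ioi fun s hs => ?_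
    have hs' : (0 : ℝ) < s := hs
    have hRs : 0 < R * s := mul_pos hR hs'
    rw [mul_left_comm, packetHat_lightcone k hRs y, packetWeight, Complex.real_smul,
      inv_mul_cancel_left₀ hR.ne']
    have : (R : ℂ) ≠ 0 := by exact_mod_cast hR.ne'
    have : (s : ℂ) ≠ 0 := by exact_mod_cast hs'.ne'
    push_cast
    field_simp
  simp_rw [hfib]
  refine integral_integral_swap ?_
  refine packetWeight_integrable hk.continuous hl₀ hk0 hR ha (g := fun w : Space n × ℝ =>
    m (lightcone (R * w.2) w.1) *
      Complex.exp (-(Complex.I * ((t₀ * ‖lightcone (R * w.2) w.1‖ : ℝ) : ℂ)))) ?_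
    (B := B) fun w => ?_
  · have h1 : Measurable fun w : Space n × ℝ => lightcone (R * w.2) w.1 :=
      measurable_lightcone.comp (f := fun w : Space n × ℝ => (w.1, R * w.2)) (by fun_prop)
    exact (hm.comp h1).mul (by fun_prop)
  · rw [norm_mul, ← mul_neg, ← Complex.ofReal_neg, Complex.norm_exp_I_mul_ofReal, mul_one]
    exact hB _


/-! ### Size of the wave packet at time zero -/

/-- The radial profile `k(s) s^{n/2-1}`. -/
def packetProfile (n : ℕ) (k : ℝ → ℝ) (s : ℝ) : ℝ := k s / s * s ^ ((n : ℝ) / 2)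

theorem packetProfile_contDiff {n : ℕ} {k : ℝ → ℝ} (hk : ContDiff ℝ ∞ k) {l₀ l₁ : ℝ}
    (hl₀ : 0 < l₀) (hk0 : ∀ s, s ∉ Icc l₀ l₁ → k s = 0) : ContDiff ℝ ∞ (packetProfile n k) := by
  rw [contDiff_iff_contDiffAt]
  intro s
  rcases lt_or_ge s l₀ with h | h
  · have : packetProfile n k =ᶠ[𝓝 s] fun _ => 0 := by
      filter_upwards [Iio_mem_nhds h] with x hx
      simp [packetProfile, hk0 x fun hx' => absurd hx'.1 (not_le.2 hx)]
    exact contDiffAt_const.congr_of_eventuallyEq this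
  · have hs : s ≠ 0 := (hl₀.trans_le h).ne'
    exact (hk.contDiffAt.div contDiffAt_id hs).mul (Real.contDiffAt_rpow_const_of_ne hs)

theorem cpow_pos_mul {r : ℝ} (hr : 0 < r) {z : ℂ} (hz : z ≠ 0) (c : ℝ) :
    ((r : ℂ) * z) ^ (c : ℂ) = ((r ^ c : ℝ) : ℂ) * z ^ (c : ℂ) := by
  have hr' : (r : ℂ) ≠ 0 := by exact_mod_cast hr.ne'
  rw [Complex.cpow_def_of_ne_zero (mul_ne_zero hr' hz), Complex.log_ofReal_mul hr hz, add_mul,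
    Complex.exp_add, ← Complex.cpow_def_of_ne_zero hz, Complex.ofReal_cpow hr.le,
    Complex.cpow_def_of_ne_zero hr', Complex.ofReal_log hr.le]

/-- The complex distance governing the size of a wave packet. -/
def packetPhase {n : ℕ} (a t₀ : ℝ) (x : Space (n + 1)) : ℂ :=
  ((x 0 - t₀) / 2 : ℝ) +
    Complex.I * ((‖transverse x‖ ^ 2 : ℝ) : ℂ) / (2 * (a + (x 0 + t₀ : ℝ) * Complex.I))

/-- With σ = x₁ + t₀ and ν = |x'|²/(a² + σ²), the real part vanishes where σ(1 + ν) = 2t₀, which is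
an a-perturbation of the sphere |x| = t₀. The imaginary part aν/2 is nonnegative and localizes the
packet to a cap. -/
theorem packetPhase_eq {n : ℕ} {a : ℝ} (ha : 0 < a) (t₀ : ℝ) (x : Space (n + 1)) :
    packetPhase a t₀ x =
      ((((x 0 + t₀) * (1 + ‖transverse x‖ ^ 2 / (a ^ 2 + (x 0 + t₀) ^ 2)) - 2 * t₀) / 2 : ℝ) : ℂ) +
      ((a * (‖transverse x‖ ^ 2 / (a ^ 2 + (x 0 + t₀) ^ 2)) / 2 : ℝ) : ℂ) * Complex.I := by
  have hx : x 0 - t₀ = (x 0 + t₀) - 2 * t₀ := by ring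
  rw [packetPhase, hx]
  generalize x 0 + t₀ = σ
  generalize ‖transverse x‖ ^ 2 = u
  have hp : ((a ^ 2 + σ ^ 2 : ℝ) : ℂ) ≠ 0 := by
    have : 0 < a ^ 2 + σ ^ 2 := by positivity
    exact_mod_cast this.ne'
  have hz : ((a : ℂ) + σ * Complex.I) ≠ 0 := fun h => by
    have := congrArg Complex.re h
    simp at this
    linarith
  push_cast at hp ⊢
  field_simp
  ring_nf
  simp only [Complex.I_sq]
  ring

theorem packetPhase_re {n : ℕ} {a : ℝ} (ha : 0 < a) (t₀ : ℝ) (x : Space (n + 1)) :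
    (packetPhase a t₀ x).re =
      ((x 0 + t₀) * (1 + ‖transverse x‖ ^ 2 / (a ^ 2 + (x 0 + t₀) ^ 2)) - 2 * t₀) / 2 := by
  rw [packetPhase_eq ha, Complex.add_re, Complex.ofReal_re, Complex.re_ofReal_mul, Complex.I_re,
    mul_zero, add_zero]

theorem packetPhase_im {n : ℕ} {a : ℝ} (ha : 0 < a) (t₀ : ℝ) (x : Space (n + 1)) :
    (packetPhase a t₀ x).im = a * (‖transverse x‖ ^ 2 / (a ^ 2 + (x 0 + t₀) ^ 2)) / 2 := by
  rw [packetPhase_eq ha, Complex.add_im, Complex.ofReal_im, Complex.im_ofReal_mul, Complex.I_im,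
    mul_one, zero_add]

/-- In light-cone coordinates ⟨x,ξ⟩ - t₀|ξ| equals l(x₁ - t₀)/2 + ⟨x',y⟩ - (x₁ + t₀)|y|²/(2l). So
the y-integral is Gaussian with complex rate (a + i(x₁ + t₀))/(2l), and completing the square
contributes another term linear in l. -/
theorem integral_packetHat_eq {n : ℕ} {k : ℝ → ℝ} (hk : ContDiff ℝ ∞ k) {l₀ l₁ : ℝ}
    (hl₀ : 0 < l₀) (hk0 : ∀ s, s ∉ Icc l₀ l₁ → k s = 0) {R a : ℝ} (hR : 0 < R) (ha : 0 < a)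
    (t₀ : ℝ) (x : Space (n + 1)) :
    ∫ ξ, Complex.exp (Complex.I * ((inner ℝ x ξ : ℝ) : ℂ)) * packetHat k R a t₀ ξ =
      (((2 * Real.pi * R) ^ ((n : ℝ) / 2) : ℝ) : ℂ) *
        ((a + (x 0 + t₀ : ℝ) * Complex.I)⁻¹ : ℂ) ^ (((n : ℝ) / 2 : ℝ) : ℂ) *
        ∫ s : ℝ, (packetProfile n k s : ℂ) *
          Complex.exp (Complex.I * s * (R * packetPhase a t₀ x)) := by
  rw [integral_mul_packetHat hk hl₀ hk0 hR ha t₀ (B := 1) (by fun_prop)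
    (fun ξ => (Complex.norm_exp_I_mul_ofReal _).le)]
  set z : ℂ := a + (x 0 + t₀ : ℝ) * Complex.I with hz
  have hzre : z.re = a := by simp [z]
  have hz0 : z ≠ 0 := fun h => by rw [h] at hzre; simp at hzre; linarith
  have hzero : ∀ s, s ∉ Ioi (0 : ℝ) → (packetProfile n k s : ℂ) *
      Complex.exp (Complex.I * s * (R * packetPhase a t₀ x)) = 0 := by
    intro s hs
    have : k s = 0 := hk0 s fun h => hs (hl₀.trans_le h.1)
    simp [packetProfile, this]
  rw [← setIntegral_eq_integral_of_forall_compl_eq_zero hzero, ← integral_const_mul]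
  refine setIntegral_congr_fun measurableSet_Ioi fun s hs => ?_
  have hs' : (0 : ℝ) < s := hs
  have hl : 0 < R * s := mul_pos hR hs'
  have hlC : ((R * s : ℝ) : ℂ) ≠ 0 := by exact_mod_cast hl.ne'
  have hRC : (R : ℂ) ≠ 0 := by exact_mod_cast hR.ne'
  have hsC : (s : ℂ) ≠ 0 := by exact_mod_cast hs'.ne'
  set b : ℂ := ((2 * (R * s))⁻¹ : ℝ) * z with hb
  have hbre : 0 < b.re := by rw [hb, Complex.re_ofReal_mul, hzre]; positivity
  have hpt : ∀ y : Space n, (packetWeight k R a s y : ℂ) *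
      (Complex.exp (Complex.I * ((inner ℝ x (lightcone (R * s) y) : ℝ) : ℂ)) *
        Complex.exp (-(Complex.I * ((t₀ * ‖lightcone (R * s) y‖ : ℝ) : ℂ)))) =
      ((k s / s : ℝ) : ℂ) * Complex.exp (Complex.I * (R * s * (x 0 - t₀) / 2)) *
        Complex.exp (-b * (‖y‖ : ℂ) ^ 2 + Complex.I * ((inner ℝ (transverse x) y : ℝ) : ℂ)) := by
    intro y
    rw [packetWeight, Complex.ofReal_mul, mul_assoc, mul_assoc, Complex.ofReal_exp,
      ← Complex.exp_add, ← Complex.exp_add, ← Complex.exp_add, norm_lightcone hl, inner_eq]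
    simp only [lightcone, glue_zero, transverse_glue]
    congr 2
    rw [hb, hz]
    push_cast
    field_simp
    ring
  simp_rw [hpt]
  rw [integral_const_mul, GaussianFourier.integral_cexp_neg_mul_sq_norm_add hbre,
    finrank_euclideanSpace_fin]
  have h1 : (Real.pi / b : ℂ) ^ ((n : ℂ) / 2) =
      (((2 * Real.pi * R) ^ ((n : ℝ) / 2) * s ^ ((n : ℝ) / 2) : ℝ) : ℂ) *
        (z⁻¹) ^ (((n : ℝ) / 2 : ℝ) : ℂ) := by
    rw [← Real.mul_rpow (by positivity) hs'.le, ← cpow_pos_mul (by positivity) (inv_ne_zero hz0)]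
    rw [hb]
    push_cast
    congr 1
    field_simp
  have h2 : Complex.exp (Complex.I * s * (R * packetPhase a t₀ x)) =
      Complex.exp (Complex.I * (R * s * (x 0 - t₀) / 2)) *
        Complex.exp (Complex.I ^ 2 * (‖transverse x‖ : ℂ) ^ 2 / (4 * b)) := by
    rw [← Complex.exp_add, packetPhase, ← hz, hb]
    congr 1
    push_cast
    field_simp
    ring
  rw [h1, h2, packetProfile]
  push_cast
  ring

/-- Apply `norm_laplace_le` at Rw, w being the packet phase: polynomial decay comes from Re w and
exponential decay from Im w. The factor 2^N absorbs the 1/2 in Re w. -/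
theorem norm_integral_packetHat_le {n : ℕ} {k : ℝ → ℝ} (hk : ContDiff ℝ ∞ k) {l₀ l₁ : ℝ}
    (hl₀ : 0 < l₀) (hk0 : ∀ s, s ∉ Icc l₀ l₁ → k s = 0) (N : ℕ) :
    ∃ C, 0 < C ∧ ∀ (R a t₀ : ℝ), 0 < R → 0 < a → ∀ x : Space (n + 1),
    ‖∫ ξ, Complex.exp (Complex.I * ((inner ℝ x ξ : ℝ) : ℂ)) * packetHat k R a t₀ ξ‖ ≤
      C * R ^ ((n : ℝ) / 2) * ((√(a ^ 2 + (x 0 + t₀) ^ 2) ^ ((n : ℝ) / 2))⁻¹ *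
        ((1 + R * |(x 0 + t₀) * (1 + ‖transverse x‖ ^ 2 / (a ^ 2 + (x 0 + t₀) ^ 2))
          - 2 * t₀|) ^ N)⁻¹ *
        Real.exp (-(l₀ * R * a / 2 * (‖transverse x‖ ^ 2 / (a ^ 2 + (x 0 + t₀) ^ 2))))) := by
  obtain ⟨C, hC0, hC⟩ := norm_laplace_le (l₀ := l₀) (l₁ := l₁)
    (κ := fun s => (packetProfile n k s : ℂ))
    (Complex.ofRealCLM.contDiff.comp (packetProfile_contDiff hk hl₀ hk0))
    (fun s hs => by simp [packetProfile, hk0 s hs]) N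
  refine ⟨(2 * Real.pi) ^ ((n : ℝ) / 2) * (C * 2 ^ N), by positivity, fun R a t₀ hR ha x => ?_⟩
  rw [integral_packetHat_eq hk hl₀ hk0 hR ha, norm_mul, norm_mul]
  have hre := packetPhase_re ha t₀ x
  have him := packetPhase_im ha t₀ x
  set ν := ‖transverse x‖ ^ 2 / (a ^ 2 + (x 0 + t₀) ^ 2)
  have hν : 0 ≤ ν := by positivity
  set w := packetPhase a t₀ x
  have hwim : ((R : ℂ) * w).im = R * w.im := Complex.im_ofReal_mul _ _
  have h1 := hC (R * w) (by rw [hwim, him]; positivity)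
  have h2 : ‖(((2 * Real.pi * R) ^ ((n : ℝ) / 2) : ℝ) : ℂ)‖ =
      (2 * Real.pi) ^ ((n : ℝ) / 2) * R ^ ((n : ℝ) / 2) := by
    rw [Complex.norm_real, Real.norm_of_nonneg (by positivity),
      Real.mul_rpow (by positivity) hR.le]
  have h3 : ‖((a + (x 0 + t₀ : ℝ) * Complex.I)⁻¹ : ℂ) ^ (((n : ℝ) / 2 : ℝ) : ℂ)‖ =
      (√(a ^ 2 + (x 0 + t₀) ^ 2) ^ ((n : ℝ) / 2))⁻¹ := by
    have hz0 : ((a : ℂ) + (x 0 + t₀ : ℝ) * Complex.I) ≠ 0 := fun h => by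
      have := congrArg Complex.re h
      simp at this
      linarith
    rw [Complex.norm_cpow_real, norm_inv, Complex.norm_add_mul_I,
      Real.inv_rpow (Real.sqrt_nonneg _)]
  have h4 : 1 + R * |(x 0 + t₀) * (1 + ν) - 2 * t₀| ≤ 2 * (1 + ‖(R : ℂ) * w‖) := by
    have : |w.re| ≤ ‖w‖ := Complex.abs_re_le_norm w
    rw [hre, abs_div, abs_of_pos (two_pos : (0 : ℝ) < 2)] at this
    rw [norm_mul, Complex.norm_real, Real.norm_of_nonneg hR.le]
    nlinarith
  have h5 : ((1 + ‖(R : ℂ) * w‖) ^ N)⁻¹ ≤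
      2 ^ N * ((1 + R * |(x 0 + t₀) * (1 + ν) - 2 * t₀|) ^ N)⁻¹ := by
    rw [← div_eq_mul_inv, le_div_iff₀ (by positivity), inv_mul_le_iff₀ (by positivity),
      ← mul_pow]
    gcongr
    linarith
  have h6 : Real.exp (-(l₀ * ((R : ℂ) * w).im)) = Real.exp (-(l₀ * R * a / 2 * ν)) := by
    rw [hwim, him]; congr 1; ring
  rw [h2, h3]
  rw [h6] at h1
  calc _ ≤ (2 * Real.pi) ^ ((n : ℝ) / 2) * R ^ ((n : ℝ) / 2) *
        (√(a ^ 2 + (x 0 + t₀) ^ 2) ^ ((n : ℝ) / 2))⁻¹ *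
        (C * (2 ^ N * ((1 + R * |(x 0 + t₀) * (1 + ν) - 2 * t₀|) ^ N)⁻¹) *
          Real.exp (-(l₀ * R * a / 2 * ν))) := by
        gcongr
        refine h1.trans ?_
        gcongr
    _ = _ := by ring


/-- The majorant of a wave packet at time zero: `σ` is the shifted first coordinate and `ν` the
squared transverse distance in units of `(a² + σ²)^{1/2}`. -/
def packetMajorant (n N : ℕ) (l₀ R a t₀ σ ν : ℝ) : ℝ :=
  (√(a ^ 2 + σ ^ 2) ^ ((n : ℝ) / 2))⁻¹ * ((1 + R * |σ * (1 + ν) - 2 * t₀|) ^ N)⁻¹ *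
    Real.exp (-(l₀ * R * a / 2 * ν))

/-- The danger is a small ζ = √(a² + σ²). If σ(1 + ν) ≥ 1, then ζ⁻¹ ≤ 1 + ν, and the exponential
beats (1 + ν)^n since Ra ≥ 1. Otherwise |σ(1 + ν) - 2t₀| ≥ 1, so the polynomial factor is at most
R^{-N}, which pays for ζ⁻¹ ≤ a⁻¹ ≤ R. -/
theorem packetMajorant_le (n : ℕ) {l₀ : ℝ} (hl₀ : 0 < l₀) : ∃ C, 0 < C ∧
    ∀ (N : ℕ) (R a t₀ σ ν : ℝ), n ≤ N → 1 ≤ R → 0 < a → 1 ≤ R * a → 1 ≤ t₀ → 0 ≤ ν →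
      packetMajorant n N l₀ R a t₀ σ ν ≤ C := by
  set C₀ : ℝ := n.factorial * (2 / l₀) ^ n * Real.exp (l₀ / 2) with hC₀
  have hC₀0 : 0 < C₀ := by positivity
  refine ⟨C₀ + 1, by positivity, fun N R a t₀ σ ν hN hR ha hRa ht hν => ?_⟩
  set ζ := √(a ^ 2 + σ ^ 2) with hζ
  have hζ0 : 0 < ζ := Real.sqrt_pos.2 (by positivity)
  have hζa : a ≤ ζ := Real.le_sqrt_of_sq_le (by nlinarith [sq_nonneg σ])
  have hζσ : σ ≤ ζ := Real.le_sqrt_of_sq_le (by nlinarith)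
  have hR0 : 0 < R := by linarith
  have hpow : ∀ y : ℝ, 1 ≤ y → ζ⁻¹ ≤ y → (ζ ^ ((n : ℝ) / 2))⁻¹ ≤ y ^ n := by
    intro y hy hζy
    rw [← Real.inv_rpow hζ0.le]
    calc (ζ⁻¹) ^ ((n : ℝ) / 2) ≤ y ^ ((n : ℝ) / 2) := by gcongr
      _ ≤ y ^ (n : ℝ) := Real.rpow_le_rpow_of_exponent_le hy (by
          have : (0 : ℝ) ≤ n := by positivity
          linarith)
      _ = y ^ n := Real.rpow_natCast _ _
  have hdec : (1 : ℝ) ≤ (1 + R * |σ * (1 + ν) - 2 * t₀|) ^ N :=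
    one_le_pow₀ (by have := abs_nonneg (σ * (1 + ν) - 2 * t₀); nlinarith)
  unfold packetMajorant
  rw [← hζ]
  rcases le_or_gt 1 (σ * (1 + ν)) with h | h
  · have h1 : (ζ ^ ((n : ℝ) / 2))⁻¹ ≤ (1 + ν) ^ n := by
      apply hpow _ (by linarith)
      rw [inv_le_iff_one_le_mul₀ hζ0]
      nlinarith
    have h2 : Real.exp (-(l₀ * R * a / 2 * ν)) ≤ Real.exp (-(l₀ / 2 * ν)) := by
      apply Real.exp_le_exp.2
      have : l₀ / 2 * ν * 1 ≤ l₀ / 2 * ν * (R * a) := by gcongr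
      nlinarith
    have h3 : (1 + ν) ^ n * Real.exp (-(l₀ / 2 * ν)) ≤ C₀ := by
      have h4 := Real.pow_div_factorial_le_exp (l₀ / 2 * (1 + ν)) (by positivity) n
      rw [div_le_iff₀ (by positivity), mul_pow] at h4
      have h5 : Real.exp (l₀ / 2 * (1 + ν)) = Real.exp (l₀ / 2) * Real.exp (l₀ / 2 * ν) := by
        rw [← Real.exp_add]; congr 1; ring
      rw [h5] at h4
      rw [Real.exp_neg, ← div_eq_mul_inv, div_le_iff₀ (Real.exp_pos _), hC₀]
      have h6 : (2 / l₀) ^ n * (l₀ / 2) ^ n = 1 := by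
        rw [← mul_pow, show 2 / l₀ * (l₀ / 2) = 1 by field_simp, one_pow]
      calc (1 + ν) ^ n = (2 / l₀) ^ n * ((l₀ / 2) ^ n * (1 + ν) ^ n) := by
            rw [← mul_assoc, h6, one_mul]
        _ ≤ (2 / l₀) ^ n * (Real.exp (l₀ / 2) * Real.exp (l₀ / 2 * ν) * n.factorial) := by gcongr
        _ = _ := by ring
    calc _ ≤ (1 + ν) ^ n * 1 * Real.exp (-(l₀ / 2 * ν)) := by
          gcongr
          exact inv_le_one_of_one_le₀ hdec
      _ ≤ C₀ := by rw [mul_one]; exact h3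
      _ ≤ _ := by linarith
  · have h1 : (ζ ^ ((n : ℝ) / 2))⁻¹ ≤ R ^ n := by
      apply hpow _ hR
      rw [inv_le_iff_one_le_mul₀ hζ0]
      nlinarith
    have h2 : R ^ n ≤ (1 + R * |σ * (1 + ν) - 2 * t₀|) ^ N := by
      have h3 : 1 ≤ |σ * (1 + ν) - 2 * t₀| := by
        rw [abs_of_neg (by linarith)]; linarith
      calc R ^ n ≤ R ^ N := pow_le_pow_right₀ hR hN
        _ ≤ _ := by gcongr; nlinarith
    have h3 : Real.exp (-(l₀ * R * a / 2 * ν)) ≤ 1 := Real.exp_le_one_iff.2 (by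
      have : 0 ≤ l₀ * R * a / 2 * ν := by positivity
      linarith)
    calc _ ≤ (1 + R * |σ * (1 + ν) - 2 * t₀|) ^ N *
          ((1 + R * |σ * (1 + ν) - 2 * t₀|) ^ N)⁻¹ * 1 := by
          gcongr
          exact h1.trans h2
      _ = 1 := by rw [mul_inv_cancel₀ (by positivity), one_mul]
      _ ≤ _ := by linarith

/-! ### `L^1` mass of the majorant and `L^p` size of the packet. -/

theorem lintegral_comp_smul_space {n : ℕ} (g : Space n → ℝ≥0∞) {r : ℝ} (hr : 0 < r) :
    ∫⁻ y, g (r⁻¹ • y) = ENNReal.ofReal (r ^ n) * ∫⁻ y, g y := by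
  have h1 := (Homeomorph.smulOfNeZero r⁻¹ (inv_ne_zero hr.ne') :
    Space n ≃ₜ Space n).toMeasurableEquiv.measurableEmbedding.lintegral_map
    (μ := volume) g
  have h2 : Measure.map (⇑(Homeomorph.smulOfNeZero r⁻¹ (inv_ne_zero hr.ne') :
      Space n ≃ₜ Space n).toMeasurableEquiv) volume =
      ENNReal.ofReal (r ^ n) • (volume : Measure (Space n)) := by
    have := Measure.map_addHaar_smul (volume : Measure (Space n)) (inv_ne_zero hr.ne')
    rw [finrank_euclideanSpace_fin, inv_pow, inv_inv, abs_of_pos (by positivity)] at this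
    exact this
  rw [h2, lintegral_smul_measure] at h1
  exact h1.symm

theorem lintegral_affine (g : ℝ → ℝ≥0∞) {r : ℝ} (hr : 0 < r) (c : ℝ) :
    ∫⁻ s, g (r * s + c) = ENNReal.ofReal r⁻¹ * ∫⁻ s, g s := by
  have h1 := (Homeomorph.mulLeft₀ r hr.ne').toMeasurableEquiv.measurableEmbedding.lintegral_map
    (μ := volume) fun s => g (s + c)
  have h2 : Measure.map (⇑(Homeomorph.mulLeft₀ r hr.ne').toMeasurableEquiv) volume =
      ENNReal.ofReal r⁻¹ • (volume : Measure ℝ) := by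
    have := Real.map_volume_mul_left hr.ne'
    rw [abs_of_pos (by positivity)] at this
    exact this
  rw [h2, lintegral_smul_measure, lintegral_add_right_eq_self g c] at h1
  exact h1.symm

theorem lintegral_gaussian {n : ℕ} {β : ℝ} (hβ : 0 < β) :
    ∫⁻ y : Space n, ENNReal.ofReal (Real.exp (-(β * ‖y‖ ^ 2))) =
      ENNReal.ofReal ((Real.pi / β) ^ ((n : ℝ) / 2)) := by
  obtain ⟨h1, h2⟩ := integral_gaussian (n := n) hβ
  rw [← h2, ofReal_integral_eq_lintegral_ofReal h1
    (Eventually.of_forall fun _ => (Real.exp_pos _).le)]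
  simp only [neg_mul]

/-- Here b stands for 1 + |y|² after rescaling y. With τ = R|(s + t₀)b - 2t₀| the weight is at most
(A + 4)^(n/2) (1 + τ)^n. Of the n + 2 powers of decay, n pay for it, and the other two leave a
Cauchy kernel of mass π/(Rb). -/
theorem lintegral_packet_radial (n : ℕ) {A : ℝ} (hA : 0 < A) {R a t₀ b : ℝ} (hR : 1 ≤ R)
    (ha : 0 < a) (haA : a ≤ A) (ht : 1 ≤ t₀) (ht2 : t₀ ≤ 2) (hb : 1 ≤ b) :
    ∫⁻ s : ℝ, ENNReal.ofReal (√(a ^ 2 + (s + t₀) ^ 2) ^ ((n : ℝ) / 2) *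
      ((1 + R * |(s + t₀) * b - 2 * t₀|) ^ (n + 2))⁻¹) ≤
      ENNReal.ofReal ((A + 4) ^ ((n : ℝ) / 2) * Real.pi * R⁻¹) := by
  have hR0 : 0 < R := by linarith
  have hb0 : 0 < b := by linarith
  have hpt : ∀ s : ℝ, √(a ^ 2 + (s + t₀) ^ 2) ^ ((n : ℝ) / 2) *
      ((1 + R * |(s + t₀) * b - 2 * t₀|) ^ (n + 2))⁻¹ ≤
      (A + 4) ^ ((n : ℝ) / 2) * (1 + (R * b * s + R * (t₀ * b - 2 * t₀)) ^ 2)⁻¹ := by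
    intro s
    set τ := R * |(s + t₀) * b - 2 * t₀| with hτ
    have hτ0 : 0 ≤ τ := by positivity
    have h1 : √(a ^ 2 + (s + t₀) ^ 2) ≤ (A + 4) * (1 + τ) := by
      have e1 : √(a ^ 2 + (s + t₀) ^ 2) ≤ a + |s + t₀| := by
        rw [Real.sqrt_le_iff]
        refine ⟨by positivity, ?_⟩
        nlinarith [sq_abs (s + t₀), abs_nonneg (s + t₀), mul_nonneg ha.le (abs_nonneg (s + t₀))]
      have e2 : |s + t₀| ≤ |(s + t₀) * b| := by
        rw [abs_mul, abs_of_pos hb0]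
        exact le_mul_of_one_le_right (abs_nonneg _) hb
      have e3 : |(s + t₀) * b| ≤ |(s + t₀) * b - 2 * t₀| + 4 := by
        have := abs_sub_abs_le_abs_sub ((s + t₀) * b) (2 * t₀)
        rw [abs_of_pos (show (0 : ℝ) < 2 * t₀ by linarith)] at this
        linarith
      have e4 : |(s + t₀) * b - 2 * t₀| ≤ τ := le_mul_of_one_le_left (abs_nonneg _) hR
      nlinarith [mul_nonneg hA.le hτ0]
    have h2 : √(a ^ 2 + (s + t₀) ^ 2) ^ ((n : ℝ) / 2) ≤
        (A + 4) ^ ((n : ℝ) / 2) * (1 + τ) ^ n := by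
      calc _ ≤ ((A + 4) * (1 + τ)) ^ ((n : ℝ) / 2) := by gcongr
        _ = (A + 4) ^ ((n : ℝ) / 2) * (1 + τ) ^ ((n : ℝ) / 2) :=
            Real.mul_rpow (by positivity) (by positivity)
        _ ≤ (A + 4) ^ ((n : ℝ) / 2) * (1 + τ) ^ (n : ℝ) := by
            gcongr
            · linarith
            · have : (0 : ℝ) ≤ n := by positivity
              linarith
        _ = _ := by rw [Real.rpow_natCast]
    have h3 : τ ^ 2 = (R * b * s + R * (t₀ * b - 2 * t₀)) ^ 2 := by
      rw [hτ, mul_pow, sq_abs]; ring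
    calc _ ≤ (A + 4) ^ ((n : ℝ) / 2) * (1 + τ) ^ n * ((1 + τ) ^ (n + 2))⁻¹ := by gcongr
      _ = (A + 4) ^ ((n : ℝ) / 2) * ((1 + τ) ^ 2)⁻¹ := by
        rw [pow_add]; field_simp
      _ ≤ _ := by
        rw [← h3]
        gcongr
        nlinarith
  calc _ ≤ ∫⁻ s : ℝ, ENNReal.ofReal ((A + 4) ^ ((n : ℝ) / 2) *
        (1 + (R * b * s + R * (t₀ * b - 2 * t₀)) ^ 2)⁻¹) :=
        lintegral_mono fun s => ENNReal.ofReal_le_ofReal (hpt s)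
    _ = ENNReal.ofReal (R * b)⁻¹ *
        ∫⁻ s : ℝ, ENNReal.ofReal ((A + 4) ^ ((n : ℝ) / 2) * (1 + s ^ 2)⁻¹) :=
        lintegral_affine (fun s => ENNReal.ofReal ((A + 4) ^ ((n : ℝ) / 2) * (1 + s ^ 2)⁻¹))
          (mul_pos hR0 hb0) _
    _ = ENNReal.ofReal ((R * b)⁻¹ * ((A + 4) ^ ((n : ℝ) / 2) * Real.pi)) := by
        rw [← ofReal_integral_eq_lintegral_ofReal (integrable_inv_one_add_sq.const_mul _)
          (Eventually.of_forall fun s => by positivity), integral_const_mul,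
          integral_univ_inv_one_add_sq, ← ENNReal.ofReal_mul (by positivity)]
    _ ≤ _ := by
        apply ENNReal.ofReal_le_ofReal
        rw [mul_comm]
        gcongr
        exact le_mul_of_one_le_right hR0.le hb

/-- For fixed first coordinate, scale y by ζ = √(a² + (s + t₀)²): ν becomes |y|² and the Jacobian
ζ^n turns ζ^(-n/2) into ζ^(n/2). The Gaussian factor is then independent of s, so integrating in s
first gives R⁻¹ and then in y gives (Ra)^(-n/2). -/
theorem lintegral_packetMajorant_le (n : ℕ) {l₀ A : ℝ} (hl₀ : 0 < l₀) (hA : 0 < A) :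
    ∃ C, 0 < C ∧ ∀ R a t₀ : ℝ, 1 ≤ R → 0 < a → a ≤ A → 1 ≤ t₀ → t₀ ≤ 2 →
      ∫⁻ x : Space (n + 1), ENNReal.ofReal (packetMajorant n (n + 2) l₀ R a t₀ (x 0 + t₀)
        (‖transverse x‖ ^ 2 / (a ^ 2 + (x 0 + t₀) ^ 2))) ≤
        ENNReal.ofReal (C * (R⁻¹ * ((R * a) ^ ((n : ℝ) / 2))⁻¹)) := by
  refine ⟨(A + 4) ^ ((n : ℝ) / 2) * Real.pi * (2 * Real.pi / l₀) ^ ((n : ℝ) / 2), by positivity,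
    fun R a t₀ hR ha haA ht ht2 => ?_⟩
  have hR0 : 0 < R := by linarith
  rw [lintegral_glue, Measure.volume_eq_prod, lintegral_prod]
  swap
  · apply Measurable.aemeasurable
    simp only [glue_zero, transverse_glue, packetMajorant]
    fun_prop
  simp only [glue_zero, transverse_glue]
  have hscale : ∀ s : ℝ, ∫⁻ y : Space n, ENNReal.ofReal (packetMajorant n (n + 2) l₀ R a t₀ (s + t₀)
      (‖y‖ ^ 2 / (a ^ 2 + (s + t₀) ^ 2))) =
      ∫⁻ y : Space n, ENNReal.ofReal (√(a ^ 2 + (s + t₀) ^ 2) ^ n) *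
        ENNReal.ofReal (packetMajorant n (n + 2) l₀ R a t₀ (s + t₀) (‖y‖ ^ 2)) := by
    intro s
    have hp : 0 < a ^ 2 + (s + t₀) ^ 2 := by positivity
    have hζ : 0 < √(a ^ 2 + (s + t₀) ^ 2) := Real.sqrt_pos.2 hp
    rw [lintegral_const_mul' _ _ ENNReal.ofReal_ne_top, ← lintegral_comp_smul_space
      (fun y : Space n => ENNReal.ofReal (packetMajorant n (n + 2) l₀ R a t₀ (s + t₀) (‖y‖ ^ 2))) hζ]
    refine lintegral_congr fun y => ?_
    congr 2
    rw [norm_smul, mul_pow, norm_inv, Real.norm_of_nonneg hζ.le, inv_pow, Real.sq_sqrt hp.le]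
    field_simp
  simp_rw [hscale]
  rw [lintegral_lintegral_swap]
  swap
  · apply Measurable.aemeasurable
    unfold packetMajorant Function.uncurry
    fun_prop
  have hinner : ∀ y : Space n, ∫⁻ s : ℝ, ENNReal.ofReal (√(a ^ 2 + (s + t₀) ^ 2) ^ n) *
      ENNReal.ofReal (packetMajorant n (n + 2) l₀ R a t₀ (s + t₀) (‖y‖ ^ 2)) ≤
      ENNReal.ofReal ((A + 4) ^ ((n : ℝ) / 2) * Real.pi * R⁻¹) *
        ENNReal.ofReal (Real.exp (-(l₀ * R * a / 2 * ‖y‖ ^ 2))) := by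
    intro y
    have hb : (1 : ℝ) ≤ 1 + ‖y‖ ^ 2 := by nlinarith [sq_nonneg ‖y‖]
    calc _ = ∫⁻ s : ℝ, ENNReal.ofReal (√(a ^ 2 + (s + t₀) ^ 2) ^ ((n : ℝ) / 2) *
          ((1 + R * |(s + t₀) * (1 + ‖y‖ ^ 2) - 2 * t₀|) ^ (n + 2))⁻¹) *
          ENNReal.ofReal (Real.exp (-(l₀ * R * a / 2 * ‖y‖ ^ 2))) := by
          refine lintegral_congr fun s => ?_
          rw [← ENNReal.ofReal_mul (by positivity), ← ENNReal.ofReal_mul (by positivity)]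
          congr 1
          unfold packetMajorant
          have hζ : 0 < √(a ^ 2 + (s + t₀) ^ 2) := Real.sqrt_pos.2 (by positivity)
          set ζ := √(a ^ 2 + (s + t₀) ^ 2)
          have : ζ ^ n = ζ ^ ((n : ℝ) / 2) * ζ ^ ((n : ℝ) / 2) := by
            rw [← Real.rpow_add hζ, add_halves, Real.rpow_natCast]
          rw [this]
          have : 0 < ζ ^ ((n : ℝ) / 2) := by positivity
          field_simp
      _ ≤ _ := by
          rw [lintegral_mul_const' _ _ ENNReal.ofReal_ne_top]
          gcongr
          exact lintegral_packet_radial n hA hR ha haA ht ht2 hb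
  calc _ ≤ ∫⁻ y : Space n, ENNReal.ofReal ((A + 4) ^ ((n : ℝ) / 2) * Real.pi * R⁻¹) *
        ENNReal.ofReal (Real.exp (-(l₀ * R * a / 2 * ‖y‖ ^ 2))) := lintegral_mono hinner
    _ = ENNReal.ofReal ((A + 4) ^ ((n : ℝ) / 2) * Real.pi * R⁻¹ *
        (Real.pi / (l₀ * R * a / 2)) ^ ((n : ℝ) / 2)) := by
        rw [lintegral_const_mul' _ _ ENNReal.ofReal_ne_top, lintegral_gaussian (by positivity),
          ← ENNReal.ofReal_mul (by positivity)]
    _ ≤ _ := by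
        apply ENNReal.ofReal_le_ofReal
        rw [show Real.pi / (l₀ * R * a / 2) = (2 * Real.pi / l₀) * (R * a)⁻¹ by field_simp,
          Real.mul_rpow (by positivity) (by positivity), Real.inv_rpow (by positivity)]
        apply le_of_eq
        ring

theorem eLpNorm_le_interpolation {α : Type*} [MeasurableSpace α] {μ : Measure α} {f : α → ℂ}
    {S L p : ℝ} (hp : 1 ≤ p) (hS : 0 < S) (hL : 0 < L) (hfS : ∀ x, ‖f x‖ ≤ S)
    (hfL : ∫⁻ x, ‖f x‖ₑ ∂μ ≤ ENNReal.ofReal L) :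
    eLpNorm f (ENNReal.ofReal p) μ ≤ ENNReal.ofReal (S ^ (1 - 1 / p) * L ^ (1 / p)) := by
  have hp0 : 0 < p := by linarith
  rw [eLpNorm_eq_lintegral_rpow_enorm_toReal (by simpa using hp0) ENNReal.ofReal_ne_top,
    ENNReal.toReal_ofReal hp0.le]
  have h1 : ∫⁻ x, ‖f x‖ₑ ^ p ∂μ ≤ ENNReal.ofReal (S ^ (p - 1) * L) := by
    calc _ ≤ ∫⁻ x, ENNReal.ofReal (S ^ (p - 1)) * ‖f x‖ₑ ∂μ := by
          refine lintegral_mono fun x => ?_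
          have : ‖f x‖ₑ ^ p = ‖f x‖ₑ ^ (p - 1) * ‖f x‖ₑ := by
            conv_rhs => rw [← ENNReal.rpow_one ‖f x‖ₑ, ← ENNReal.rpow_mul, one_mul,
              ← ENNReal.rpow_add_of_nonneg _ _ (by linarith) (by norm_num), sub_add_cancel]
          simp only [this]
          gcongr
          rw [← ENNReal.ofReal_rpow_of_nonneg hS.le (by linarith)]
          gcongr
          rw [← ofReal_norm]
          exact ENNReal.ofReal_le_ofReal (hfS x)
      _ ≤ _ := by
          rw [lintegral_const_mul' _ _ ENNReal.ofReal_ne_top, ENNReal.ofReal_mul (by positivity)]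
          gcongr
  calc _ ≤ (ENNReal.ofReal (S ^ (p - 1) * L)) ^ (1 / p) := by gcongr
    _ = _ := by
      rw [ENNReal.ofReal_rpow_of_nonneg (by positivity) (by positivity),
        Real.mul_rpow (by positivity) hL.le, ← Real.rpow_mul hS.le]
      congr 3
      field_simp

/-- The `L^p` norm of the wave packet at time zero. -/
theorem exists_packet {n : ℕ} {k : ℝ → ℝ} (hk : ContDiff ℝ ∞ k) {l₀ l₁ : ℝ}
    (hl₀ : 0 < l₀) (hk0 : ∀ s, s ∉ Icc l₀ l₁ → k s = 0) {A : ℝ} (hA : 0 < A) :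
    ∃ C, 0 < C ∧ ∀ R a t₀ : ℝ, 1 ≤ R → 0 < a → a ≤ A → 1 ≤ R * a → 1 ≤ t₀ → t₀ ≤ 2 →
      ∃ f : 𝓢(Space (n + 1), ℂ), (∀ ξ, fourierHat f ξ = packetHat k R a t₀ ξ) ∧
        ∀ p : ℝ, 1 ≤ p → eLpNorm f (ENNReal.ofReal p) volume ≤ ENNReal.ofReal
          (C * R ^ ((n : ℝ) / 2) * (R⁻¹ * ((R * a) ^ ((n : ℝ) / 2))⁻¹) ^ (1 / p)) := by
  obtain ⟨C₁, hC₁, h1⟩ := norm_integral_packetHat_le (n := n) hk hl₀ hk0 (n + 2)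
  obtain ⟨C₂, hC₂, h2⟩ := packetMajorant_le n hl₀
  obtain ⟨C₃, hC₃, h3⟩ := lintegral_packetMajorant_le n hl₀ hA
  set c : ℝ := ((2 * Real.pi) ^ (n + 1))⁻¹ with hc
  have hc0 : 0 < c := by positivity
  -- The maximum dominates C₂^(1-1/p) C₃^(1/p) for every p, so the constant does not depend on p.
  refine ⟨c * C₁ * (max C₂ C₃), by positivity, fun R a t₀ hR ha haA hRa ht ht2 => ?_⟩
  have hR0 : 0 < R := by linarith
  obtain ⟨G, hG⟩ := exists_schwartz_packetHat (n := n) hk hl₀ hk0 hR0 ha t₀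
  obtain ⟨f, hf, hfx⟩ := exists_fourierHat_eq G
  refine ⟨f, fun ξ => by rw [hf, hG], fun p hp => ?_⟩
  have hp0 : 0 < p := by linarith
  have hbd : ∀ x, ‖f x‖ ≤ c * C₁ * R ^ ((n : ℝ) / 2) *
      packetMajorant n (n + 2) l₀ R a t₀ (x 0 + t₀)
        (‖transverse x‖ ^ 2 / (a ^ 2 + (x 0 + t₀) ^ 2)) := by
    intro x
    rw [hfx, norm_mul, Complex.norm_real, Real.norm_of_nonneg hc0.le, mul_assoc, mul_assoc,
      ← mul_assoc C₁]
    gcongr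
    simp_rw [hG, mul_comm (packetHat _ _ _ _ _)]
    exact h1 R a t₀ hR0 ha x
  set L := R⁻¹ * ((R * a) ^ ((n : ℝ) / 2))⁻¹ with hL
  have hL0 : 0 < L := by positivity
  set D := c * C₁ * R ^ ((n : ℝ) / 2) with hD
  have hD0 : 0 < D := by positivity
  have hS : ∀ x, ‖f x‖ ≤ D * C₂ := fun x => (hbd x).trans (by
    gcongr
    exact h2 (n + 2) R a t₀ _ _ (by omega) hR ha hRa ht (by positivity))
  have hI : ∫⁻ x, ‖f x‖ₑ ≤ ENNReal.ofReal (D * (C₃ * L)) := by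
    calc _ ≤ ∫⁻ x : Space (n + 1), ENNReal.ofReal D * ENNReal.ofReal
          (packetMajorant n (n + 2) l₀ R a t₀ (x 0 + t₀)
            (‖transverse x‖ ^ 2 / (a ^ 2 + (x 0 + t₀) ^ 2))) := by
          refine lintegral_mono fun x => ?_
          rw [← ENNReal.ofReal_mul hD0.le, ← ofReal_norm]
          exact ENNReal.ofReal_le_ofReal (hbd x)
      _ ≤ _ := by
          rw [lintegral_const_mul' _ _ ENNReal.ofReal_ne_top, ENNReal.ofReal_mul hD0.le]
          gcongr
          exact h3 R a t₀ hR ha haA ht ht2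
  refine (eLpNorm_le_interpolation hp (mul_pos hD0 hC₂) (by positivity) hS hI).trans ?_
  apply ENNReal.ofReal_le_ofReal
  have hp1 : 1 / p ≤ 1 := by rw [div_le_one hp0]; exact hp
  have hm : 0 < max C₂ C₃ := lt_max_of_lt_left hC₂
  calc (D * C₂) ^ (1 - 1 / p) * (D * (C₃ * L)) ^ (1 / p)
      ≤ (D * max C₂ C₃) ^ (1 - 1 / p) * (D * (max C₂ C₃ * L)) ^ (1 / p) := by
        gcongr
        · exact le_max_left _ _
        · exact le_max_right _ _
    _ = D * max C₂ C₃ * L ^ (1 / p) := by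
        rw [← mul_assoc, Real.mul_rpow (x := D * max C₂ C₃) (by positivity) hL0.le, ← mul_assoc,
          ← Real.rpow_add (by positivity), sub_add_cancel, Real.rpow_one]
    _ = _ := by rw [hD]; ring


/-! ### Size of the wave packet near the focusing time -/

/-- Follows from u ≤ e^{u/2}. It lets errors growing linearly in the Gaussian exponent be integrated
as Gaussians. -/
theorem one_add_mul_exp_neg_le {u : ℝ} (hu : 0 ≤ u) :
    (1 + u) * Real.exp (-u) ≤ Real.exp (-u) + Real.exp (-(u / 2)) := by
  have h1 := Real.quadratic_le_exp_of_nonneg (show 0 ≤ u / 2 by positivity)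
  have h2 : u ≤ Real.exp (u / 2) := by nlinarith [sq_nonneg (u / 2 - 1)]
  have h3 : Real.exp (-(u / 2)) = Real.exp (u / 2) * Real.exp (-u) := by
    rw [← Real.exp_add]; congr 1; ring
  rw [h3]
  nlinarith [mul_le_mul_of_nonneg_right h2 (Real.exp_pos (-u)).le]

/-- If g differs from v by at most η|v|(1 + u), with u the Gaussian exponent, the error is at most
η(1 + 2^(n/2)) times the main term, since halving the rate multiplies the Gaussian mass by 2^(n/2).
The stated η makes this one half. Since k ≥ 0, the main term has no cancellation. -/
theorem packet_integral_lower {n : ℕ} {k : ℝ → ℝ} (hk : ContDiff ℝ ∞ k) (hkn : ∀ s, 0 ≤ k s)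
    {l₀ l₁ : ℝ} (hl₀ : 0 < l₀) (hk0 : ∀ s, s ∉ Icc l₀ l₁ → k s = 0) {R a : ℝ} (hR : 0 < R)
    (ha : 0 < a) {g : Space n × ℝ → ℂ} (hg : Measurable g) {B : ℝ} (hB : ∀ w, ‖g w‖ ≤ B) {v : ℝ}
    (hgv : ∀ s ∈ Icc l₀ l₁, ∀ y : Space n, ‖g (y, s) - v‖ ≤
      |v| / (2 * (1 + 2 ^ ((n : ℝ) / 2))) * (1 + a / (2 * (R * s)) * ‖y‖ ^ 2)) :
    |v| / 2 * ((2 * Real.pi * (R / a)) ^ ((n : ℝ) / 2) * ∫ s, packetProfile n k s) ≤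
      ‖∫ s in Ioi (0 : ℝ), ∫ y : Space n, (packetWeight k R a s y : ℂ) * g (y, s)‖ := by
  have hInt := packetWeight_integrable hk.continuous hl₀ hk0 hR ha hg hB
  have hInt2 : Integrable (fun s => ∫ y : Space n, (packetWeight k R a s y : ℂ) * g (y, s))
      (volume.restrict (Ioi 0)) := hInt.integral_prod_right
  have hprof : Integrable (packetProfile n k) :=
    (packetProfile_contDiff hk hl₀ hk0).continuous.integrable_of_hasCompactSupport
      (HasCompactSupport.intro (isCompact_Icc (a := l₀) (b := l₁))
        fun s hs => by simp [packetProfile, hk0 s hs])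
  set D : ℝ := (2 * Real.pi * (R / a)) ^ ((n : ℝ) / 2) with hD
  have hD0 : 0 < D := by positivity
  have hinner : ∀ s ∈ Ioi (0 : ℝ),
      ‖(∫ y : Space n, (packetWeight k R a s y : ℂ) * g (y, s)) -
        ((v * (D * packetProfile n k s) : ℝ) : ℂ)‖ ≤ |v| / 2 * (D * packetProfile n k s) := by
    intro s hs
    have hs0 : (0 : ℝ) < s := hs
    by_cases hsI : s ∈ Icc l₀ l₁
    swap
    · simp [packetWeight, packetProfile, hk0 s hsI]
    set β : ℝ := a / (2 * (R * s)) with hβ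
    have hβ0 : 0 < β := by positivity
    obtain ⟨hi1, he1⟩ := integral_gaussian (n := n) hβ0
    obtain ⟨hi2, he2⟩ := integral_gaussian (n := n) (half_pos hβ0)
    have hJ : (Real.pi / β) ^ ((n : ℝ) / 2) = D * s ^ ((n : ℝ) / 2) := by
      rw [hD, ← Real.mul_rpow (by positivity) hs0.le]
      congr 1
      rw [hβ]; field_simp
    have hJ2 : (Real.pi / (β / 2)) ^ ((n : ℝ) / 2) = 2 ^ ((n : ℝ) / 2) * (D * s ^ ((n : ℝ) / 2)) := by
      rw [← hJ, ← Real.mul_rpow (by positivity) (by positivity)]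
      congr 1
      field_simp
    have hprofile : (D * packetProfile n k s) =
        ∫ y : Space n, packetWeight k R a s y := by
      simp only [packetWeight]
      rw [integral_const_mul, ← hβ, he1, hJ, packetProfile]; ring
    have hwint : Integrable fun y : Space n => packetWeight k R a s y := hi1.const_mul _
    have hwgint : Integrable fun y : Space n => (packetWeight k R a s y : ℂ) * g (y, s) := by
      refine hwint.ofReal.mul_bdd (c := B) ?_ (Eventually.of_forall fun y => hB _)
      exact (hg.comp (f := fun y : Space n => (y, s)) (by fun_prop)).aestronglyMeasurable
    have heq : (∫ y : Space n, (packetWeight k R a s y : ℂ) * g (y, s)) -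
        ((v * (D * packetProfile n k s) : ℝ) : ℂ) =
        ∫ y : Space n, (packetWeight k R a s y : ℂ) * (g (y, s) - v) := by
      have hvw : Integrable fun y : Space n => (v : ℂ) * (packetWeight k R a s y : ℂ) :=
        hwint.ofReal.const_mul _
      rw [hprofile, Complex.ofReal_mul, ← integral_complex_ofReal, ← integral_const_mul,
        ← integral_sub hwgint hvw]
      congr 1
      funext y
      ring
    rw [heq]
    have hks : 0 ≤ k s / s := div_nonneg (hkn s) hs0.le
    have hη : 0 ≤ |v| / (2 * (1 + 2 ^ ((n : ℝ) / 2))) := by positivity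
    calc _ ≤ ∫ y : Space n, |v| / (2 * (1 + 2 ^ ((n : ℝ) / 2))) * (k s / s *
          (Real.exp (-β * ‖y‖ ^ 2) + Real.exp (-(β / 2) * ‖y‖ ^ 2))) := by
          refine norm_integral_le_of_norm_le (((hi1.add hi2).const_mul _).const_mul _)
            (Eventually.of_forall fun y => ?_)
          rw [norm_mul, Complex.norm_real, packetWeight, norm_mul, Real.norm_of_nonneg hks,
            Real.norm_of_nonneg (Real.exp_pos _).le, ← hβ]
          have hu : 0 ≤ β * ‖y‖ ^ 2 := by positivity
          have h1 := one_add_mul_exp_neg_le hu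
          rw [show -(β * ‖y‖ ^ 2) = -β * ‖y‖ ^ 2 by ring,
            show -(β * ‖y‖ ^ 2 / 2) = -(β / 2) * ‖y‖ ^ 2 by ring] at h1
          have h2 := hgv s hsI y
          rw [← hβ] at h2
          calc _ ≤ k s / s * Real.exp (-β * ‖y‖ ^ 2) *
                (|v| / (2 * (1 + 2 ^ ((n : ℝ) / 2))) * (1 + β * ‖y‖ ^ 2)) := by gcongr
            _ = |v| / (2 * (1 + 2 ^ ((n : ℝ) / 2))) * (k s / s *
                ((1 + β * ‖y‖ ^ 2) * Real.exp (-β * ‖y‖ ^ 2))) := by ring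
            _ ≤ _ := by gcongr
      _ = |v| / (2 * (1 + 2 ^ ((n : ℝ) / 2))) * (k s / s *
          ((1 + 2 ^ ((n : ℝ) / 2)) * (D * s ^ ((n : ℝ) / 2)))) := by
          rw [integral_const_mul, integral_const_mul, integral_add hi1 hi2, he1, he2, hJ2, hJ]
          ring
      _ = _ := by
          rw [packetProfile]
          have : (0 : ℝ) < 1 + 2 ^ ((n : ℝ) / 2) := by positivity
          field_simp
  have hzero : ∀ s, s ∉ Ioi (0 : ℝ) → packetProfile n k s = 0 := by
    intro s hs
    have : k s = 0 := hk0 s fun h => hs (hl₀.trans_le h.1)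
    simp [packetProfile, this]
  rw [← setIntegral_eq_integral_of_forall_compl_eq_zero hzero]
  have hprof' : IntegrableOn (packetProfile n k) (Ioi 0) := hprof.integrableOn
  set P := ∫ s in Ioi (0 : ℝ), packetProfile n k s with hP
  have hP0 : 0 ≤ P := setIntegral_nonneg measurableSet_Ioi fun s hs =>
    mul_nonneg (div_nonneg (hkn s) (le_of_lt hs)) (Real.rpow_nonneg (le_of_lt hs) _)
  have hdiff : ‖(∫ s in Ioi (0 : ℝ), ∫ y : Space n, (packetWeight k R a s y : ℂ) * g (y, s)) -
      ((v * (D * P) : ℝ) : ℂ)‖ ≤ |v| / 2 * (D * P) := by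
    have h1 : ((v * (D * P) : ℝ) : ℂ) =
        ∫ s in Ioi (0 : ℝ), ((v * (D * packetProfile n k s) : ℝ) : ℂ) := by
      rw [integral_complex_ofReal, integral_const_mul, integral_const_mul]
    have h2 : Integrable (fun s => ((v * (D * packetProfile n k s) : ℝ) : ℂ))
        (volume.restrict (Ioi 0)) := ((hprof'.const_mul D).const_mul v).ofReal
    rw [h1, ← integral_sub hInt2 h2, hP,
      ← integral_const_mul, ← integral_const_mul]
    exact norm_integral_le_of_norm_le ((hprof'.const_mul D).const_mul _)
      ((ae_restrict_iff' measurableSet_Ioi).2 (Eventually.of_forall hinner))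
  have h2 := norm_sub_norm_le ((v * (D * P) : ℝ) : ℂ)
    (∫ s in Ioi (0 : ℝ), ∫ y : Space n, (packetWeight k R a s y : ℂ) * g (y, s))
  rw [norm_sub_rev, Complex.norm_real, norm_mul, Real.norm_eq_abs v,
    Real.norm_of_nonneg (mul_nonneg hD0.le hP0)] at h2
  linarith

set_option maxHeartbeats 1000000 in
/-- Deviation of the symbol of the localized propagator from a constant on a wave packet. -/
theorem norm_symbol_sub_le {n : ℕ} {ψ : ℝ → ℝ} {L r₀ : ℝ}
    (hL : ∀ s, |ψ s - ψ r₀| ≤ L * |s - r₀|) {R M ℓ t t₀ ε ε' Λ s : ℝ} (hL0 : 0 ≤ L) (hR : 0 < R)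
    (hM : 0 < M) (hRℓ : 1 ≤ R * ℓ) (ht : |t - t₀| ≤ 3 * ℓ) (hε0 : 0 ≤ ε) (hε1 : ε ≤ 1)
    (hs : 0 < s) (hsΛ : s ≤ Λ) (hsε : |s / 2 - r₀| ≤ ε') {x : Space (n + 1)}
    (hx0 : |x 0 + t - t₀| ≤ ε / R) (hx : ‖transverse x‖ ^ 2 ≤ ε ^ 2 * (M * ℓ / R)) (y : Space n) :
    ‖Complex.exp (Complex.I * ((t * ‖lightcone (R * s) y‖ : ℝ) : ℂ)) *
        ((ψ (R⁻¹ * ‖lightcone (R * s) y‖) : ℝ) : ℂ) *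
        Complex.exp (Complex.I * ((inner ℝ x (lightcone (R * s) y) : ℝ) : ℂ)) *
        Complex.exp (-(Complex.I * ((t₀ * ‖lightcone (R * s) y‖ : ℝ) : ℂ))) - ψ r₀‖ ≤
      (L * (ε' + 1 / M) + |ψ r₀| * (2 * (2 * Λ + 1) * ε + 7 / M)) *
        (1 + M * ℓ / (2 * (R * s)) * ‖y‖ ^ 2) := by
  have hl : 0 < R * s := mul_pos hR hs
  have hℓ : 0 < ℓ := by
    by_contra h
    push Not at h
    nlinarith
  have hΛ : 0 < Λ := hs.trans_le hsΛ
  set u := M * ℓ / (2 * (R * s)) * ‖y‖ ^ 2 with hu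
  have hu0 : 0 ≤ u := by positivity
  -- The total phase (t - t₀)|ξ| + ⟨x,ξ⟩ with l = Rs. The box makes the first two terms small; in
  -- the third |y|²/(2l) = u/(Mℓ), so a large M does.
  set Θ : ℝ := (R * s) * (x 0 + t - t₀) / 2 + inner ℝ (transverse x) y +
    (t - t₀ - x 0) * (‖y‖ ^ 2 / (2 * (R * s))) with hΘ
  have hyu : ‖y‖ ^ 2 / (2 * (R * s)) = u / (M * ℓ) := by rw [hu]; field_simp
  have hexp : Complex.exp (Complex.I * ((t * ‖lightcone (R * s) y‖ : ℝ) : ℂ)) *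
        ((ψ (R⁻¹ * ‖lightcone (R * s) y‖) : ℝ) : ℂ) *
        Complex.exp (Complex.I * ((inner ℝ x (lightcone (R * s) y) : ℝ) : ℂ)) *
        Complex.exp (-(Complex.I * ((t₀ * ‖lightcone (R * s) y‖ : ℝ) : ℂ))) =
      ((ψ (R⁻¹ * ‖lightcone (R * s) y‖) : ℝ) : ℂ) * Complex.exp (Complex.I * (Θ : ℂ)) := by
    have e : Complex.I * (Θ : ℂ) = Complex.I * ((t * ‖lightcone (R * s) y‖ : ℝ) : ℂ) +
        Complex.I * ((inner ℝ x (lightcone (R * s) y) : ℝ) : ℂ) +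
        -(Complex.I * ((t₀ * ‖lightcone (R * s) y‖ : ℝ) : ℂ)) := by
      rw [← mul_add, ← mul_neg, ← mul_add, ← Complex.ofReal_neg, ← Complex.ofReal_add,
        ← Complex.ofReal_add]
      congr 2
      rw [inner_eq, norm_lightcone hl, hΘ]
      simp only [lightcone, glue_zero, transverse_glue]
      field_simp
      ring
    rw [e, Complex.exp_add, Complex.exp_add]
    ring
  have hψ : |ψ (R⁻¹ * ‖lightcone (R * s) y‖) - ψ r₀| ≤ L * (ε' + 1 / M) * (1 + u) := by
    -- The normalized frequency is s/2 plus a transverse correction, at most u/M because Rℓ ≥ 1.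
    have e1 : R⁻¹ * ‖lightcone (R * s) y‖ - r₀ = (s / 2 - r₀) + u / (M * (R * ℓ)) := by
      rw [norm_lightcone hl, hu]
      field_simp
      ring
    have e2 : u / (M * (R * ℓ)) ≤ 1 / M * u := by
      rw [div_le_iff₀ (by positivity)]
      have : 1 / M * u * (M * (R * ℓ)) = u * (R * ℓ) := by field_simp
      rw [this]
      nlinarith
    have e3 : 0 ≤ u / (M * (R * ℓ)) := by positivity
    have hε' : 0 ≤ ε' := (abs_nonneg _).trans hsε
    calc _ ≤ L * |R⁻¹ * ‖lightcone (R * s) y‖ - r₀| := hL _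
      _ ≤ L * (ε' + 1 / M * u) := by
          rw [e1]
          gcongr
          refine (abs_add_le _ _).trans ?_
          rw [abs_of_nonneg e3]
          linarith
      _ ≤ L * ((ε' + 1 / M) * (1 + u)) := by
          gcongr
          have : 0 < 1 / M := by positivity
          nlinarith [mul_nonneg hε' hu0]
      _ = _ := by ring
  have hΘb : |Θ| ≤ (2 * (2 * Λ + 1) * ε + 7 / M) * (1 + u) := by
    have e1 : |(R * s) * (x 0 + t - t₀) / 2| ≤ (2 * Λ + 1) * ε := by
      rw [abs_div, abs_mul, abs_of_pos hl, abs_of_pos (two_pos : (0 : ℝ) < 2)]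
      have : R * s * |x 0 + t - t₀| ≤ R * s * (ε / R) := by gcongr
      have h' : R * s * (ε / R) = s * ε := by field_simp
      rw [h'] at this
      nlinarith
    have e2 : |(inner ℝ (transverse x) y : ℝ)| ≤ (2 * Λ + 1) * ε * (1 + u) := by
      refine (abs_real_inner_le_norm _ _).trans ?_
      apply le_of_sq_le_sq _ (by positivity)
      rw [mul_pow]
      have hy2 : ‖y‖ ^ 2 = u * (2 * (R * s)) / (M * ℓ) := by rw [hu]; field_simp
      calc ‖transverse x‖ ^ 2 * ‖y‖ ^ 2 ≤ ε ^ 2 * (M * ℓ / R) * ‖y‖ ^ 2 := by gcongr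
        _ = ε ^ 2 * (2 * s * u) := by rw [hy2]; field_simp
        _ ≤ ε ^ 2 * ((2 * Λ + 1) ^ 2 * (1 + u) ^ 2) := by
            gcongr
            · nlinarith
            · nlinarith
        _ = _ := by ring
    have e3 : |(t - t₀ - x 0) * (‖y‖ ^ 2 / (2 * (R * s)))| ≤ 7 / M * u := by
      rw [hyu, abs_mul, abs_of_nonneg (show 0 ≤ u / (M * ℓ) by positivity)]
      -- 7 = 2·3 + 1: twice |t - t₀| ≤ 3ℓ, plus the box width ε/R ≤ ℓ.
      have h1 : |t - t₀ - x 0| ≤ 7 * ℓ := by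
        have h2 : t - t₀ - x 0 = 2 * (t - t₀) - (x 0 + t - t₀) := by ring
        have h3 : ε / R ≤ ℓ := by rw [div_le_iff₀ hR]; nlinarith
        rw [h2]
        have := abs_sub (2 * (t - t₀)) (x 0 + t - t₀)
        rw [abs_mul, abs_of_pos (two_pos : (0 : ℝ) < 2)] at this
        linarith
      calc _ ≤ 7 * ℓ * (u / (M * ℓ)) := by gcongr
        _ = _ := by field_simp
    have h4 : |Θ| ≤ |(R * s) * (x 0 + t - t₀) / 2| + |(inner ℝ (transverse x) y : ℝ)| +
        |(t - t₀ - x 0) * (‖y‖ ^ 2 / (2 * (R * s)))| := abs_add_three _ _ _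
    have hM7 : 0 < 7 / M := by positivity
    have h5 : 0 ≤ (2 * Λ + 1) * ε * u := by positivity
    have h6 : (2 * (2 * Λ + 1) * ε + 7 / M) * (1 + u) = (2 * Λ + 1) * ε +
        (2 * Λ + 1) * ε * (1 + u) + 7 / M * u + ((2 * Λ + 1) * ε * u + 7 / M) := by ring
    linarith
  rw [hexp]
  set p := ψ (R⁻¹ * ‖lightcone (R * s) y‖)
  have hsplit : (p : ℂ) * Complex.exp (Complex.I * (Θ : ℂ)) - ψ r₀ =
      ((p - ψ r₀ : ℝ) : ℂ) * Complex.exp (Complex.I * (Θ : ℂ)) +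
        (ψ r₀ : ℂ) * (Complex.exp (Complex.I * (Θ : ℂ)) - 1) := by
    push_cast; ring
  rw [hsplit]
  refine (norm_add_le _ _).trans ?_
  rw [norm_mul, norm_mul, Complex.norm_exp_I_mul_ofReal, mul_one, Complex.norm_real,
    Complex.norm_real, Real.norm_eq_abs, Real.norm_eq_abs]
  have h7 : ‖Complex.exp (Complex.I * (Θ : ℂ)) - 1‖ ≤ |Θ| := by
    have := Real.norm_exp_I_mul_ofReal_sub_one_le (x := Θ)
    simpa using this
  calc _ ≤ L * (ε' + 1 / M) * (1 + u) +
        |ψ r₀| * ((2 * (2 * Λ + 1) * ε + 7 / M) * (1 + u)) := by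
        exact add_le_add hψ (mul_le_mul_of_nonneg_left (h7.trans hΘb) (abs_nonneg _))
    _ = _ := by ring


theorem packetProfile_integral_pos {n : ℕ} {k : ℝ → ℝ} (hk : ContDiff ℝ ∞ k) (hkn : ∀ s, 0 ≤ k s)
    {l₀ l₁ : ℝ} (hl₀ : 0 < l₀) (hk0 : ∀ s, s ∉ Icc l₀ l₁ → k s = 0) {s₀ : ℝ} (hs₀ : k s₀ ≠ 0) :
    0 < ∫ s, packetProfile n k s := by
  have hpos : ∀ s, k s ≠ 0 → 0 < s := fun s hs => by
    by_contra h
    exact hs (hk0 s fun h' => h (hl₀.trans_le h'.1))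
  refine (packetProfile_contDiff hk hl₀ hk0).continuous.integral_pos_of_hasCompactSupport_nonneg_nonzero
    (x := s₀) (HasCompactSupport.intro (isCompact_Icc (a := l₀) (b := l₁))
        fun s hs => by simp [packetProfile, hk0 s hs]) (fun s => ?_) ?_
  · by_cases hs : k s = 0
    · simp [packetProfile, hs]
    · have := hpos s hs
      exact mul_nonneg (div_nonneg (hkn s) this.le) (Real.rpow_nonneg this.le _)
  · have := hpos s₀ hs₀
    exact mul_ne_zero (div_ne_zero hs₀ this.ne') (Real.rpow_pos_of_pos this _).ne'

/-- Near the focusing time the wave packet is large on a box around its moving center. -/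
theorem exists_packet_lower (n : ℕ) {ψ : ℝ → ℝ} (hψ : Continuous ψ) {B : ℝ} (hB : ∀ s, |ψ s| ≤ B)
    {L r₀ : ℝ} (hL0 : 0 ≤ L) (hL : ∀ s, |ψ s - ψ r₀| ≤ L * |s - r₀|) (hr₀ : 0 < r₀)
    (hne : ψ r₀ ≠ 0) :
    ∃ (k : ℝ → ℝ) (l₀ l₁ M ε c : ℝ), ContDiff ℝ ∞ k ∧ 0 < l₀ ∧ (∀ s, s ∉ Icc l₀ l₁ → k s = 0) ∧
      1 ≤ M ∧ 0 < ε ∧ 0 < c ∧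
      ∀ (j : ℕ) (ℓ t t₀ : ℝ) (f : Space (n + 1) → ℂ), 1 ≤ 2 ^ j * ℓ → |t - t₀| ≤ 3 * ℓ →
        (∀ ξ, fourierHat f ξ = packetHat k (2 ^ j) (M * ℓ) t₀ ξ) →
        ∀ x : Space (n + 1), |x 0 + t - t₀| ≤ ε / 2 ^ j →
          ‖transverse x‖ ^ 2 ≤ ε ^ 2 * (M * ℓ / 2 ^ j) →
          c * (2 ^ j / (M * ℓ)) ^ ((n : ℝ) / 2) ≤ ‖halfWaveLoc ψ j t f x‖ := by
  set V := |ψ r₀| with hV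
  have hV0 : 0 < V := abs_pos.2 hne
  -- The relative error tolerated by `packet_integral_lower`. The choices of ε', M and ε below make
  -- each of the four errors at most a quarter of it.
  set η : ℝ := 1 / (2 * (1 + 2 ^ ((n : ℝ) / 2))) with hη
  have hη0 : 0 < η := by positivity
  set ε' : ℝ := min (r₀ / 2) (η * V / (4 * (L + 1))) with hε'
  have hε'0 : 0 < ε' := lt_min (by positivity) (by positivity)
  set M : ℝ := 1 + 4 * L / (η * V) + 28 / η with hM
  have hM1 : 1 ≤ M := by
    have h1 : 0 ≤ 4 * L / (η * V) := by positivity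
    have h2 : 0 ≤ 28 / η := by positivity
    linarith
  have hM0 : 0 < M := by linarith
  set ε : ℝ := min 1 (η / (8 * (2 * (3 * r₀) + 1))) with hε
  have hε0 : 0 < ε := lt_min one_pos (by positivity)
  have hconst : L * (ε' + 1 / M) + V * (2 * (2 * (3 * r₀) + 1) * ε + 7 / M) ≤ V * η := by
    have h1 : L * ε' ≤ V * η / 4 := by
      have : ε' ≤ η * V / (4 * (L + 1)) := min_le_right _ _
      rw [le_div_iff₀ (by positivity)] at this
      nlinarith
    have h2 : L * (1 / M) ≤ V * η / 4 := by
      rw [mul_one_div, div_le_iff₀ hM0]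
      have : 4 * L / (η * V) ≤ M := by
        have h2 : 0 ≤ 28 / η := by positivity
        linarith
      rw [div_le_iff₀ (by positivity)] at this
      linarith
    have h3 : 2 * (2 * (3 * r₀) + 1) * ε ≤ η / 4 := by
      have : ε ≤ η / (8 * (2 * (3 * r₀) + 1)) := min_le_right _ _
      rw [le_div_iff₀ (by positivity)] at this
      linarith
    have h4 : 7 / M ≤ η / 4 := by
      rw [div_le_iff₀ hM0]
      have : 28 / η ≤ M := by
        have h2 : 0 ≤ 4 * L / (η * V) := by positivity
        linarith
      rw [div_le_iff₀ hη0] at this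
      linarith
    nlinarith
  -- Centered at 2r₀ because |ξ| = l/2 on the axis y = 0, so the packet sits at |ξ| ≈ r₀R, where ψ
  -- does not vanish.
  let b : ContDiffBump (2 * r₀) := ⟨ε', 2 * ε', hε'0, by linarith⟩
  have hk : ContDiff ℝ ∞ (b : ℝ → ℝ) := b.contDiff
  have hl₀ : 0 < 2 * r₀ - 2 * ε' := by
    have : ε' ≤ r₀ / 2 := min_le_left _ _
    linarith
  have hk0 : ∀ s, s ∉ Icc (2 * r₀ - 2 * ε') (2 * r₀ + 2 * ε') → b s = 0 := by
    intro s hs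
    apply b.zero_of_le_dist
    rw [Real.dist_eq]
    change 2 * ε' ≤ _
    by_contra h
    push Not at h
    rw [abs_lt] at h
    exact hs ⟨by linarith, by linarith⟩
  have hP := packetProfile_integral_pos (n := n) hk (fun _ => b.nonneg) hl₀ hk0 (s₀ := 2 * r₀)
    (by rw [b.one_of_mem_closedBall (Metric.mem_closedBall_self hε'0.le)]; norm_num)
  set P := ∫ s, packetProfile n b s
  refine ⟨b, _, _, M, ε, ((2 * Real.pi) ^ (n + 1))⁻¹ *
    (V / 2 * ((2 * Real.pi) ^ ((n : ℝ) / 2) * P)), hk, hl₀, hk0, hM1, hε0, by positivity, ?_⟩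
  intro j ℓ t t₀ f hRℓ ht hf x hx0 hx
  set R : ℝ := 2 ^ j with hR
  have hR0 : 0 < R := by positivity
  have hℓ : 0 < ℓ := by
    by_contra h
    push Not at h
    nlinarith
  have ha : 0 < M * ℓ := by positivity
  let m : Space (n + 1) → ℂ := fun ξ => Complex.exp (Complex.I * ((t * ‖ξ‖ : ℝ) : ℂ)) *
    ((ψ (R⁻¹ * ‖ξ‖) : ℝ) : ℂ) * Complex.exp (Complex.I * ((inner ℝ x ξ : ℝ) : ℂ))
  have hmm : Measurable m := by
    have := hψ.measurable
    fun_prop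
  have hmB : ∀ ξ, ‖m ξ‖ ≤ B := by
    intro ξ
    simp only [m]
    rw [norm_mul, norm_mul, Complex.norm_exp_I_mul_ofReal, Complex.norm_exp_I_mul_ofReal, one_mul,
      mul_one, Complex.norm_real]
    exact hB _
  have hval : halfWaveLoc ψ j t f x = ((((2 * Real.pi) ^ (n + 1))⁻¹ : ℝ) : ℂ) *
      ∫ ξ, m ξ * packetHat b R (M * ℓ) t₀ ξ := by
    unfold halfWaveLoc multiplierOp
    congr 2
    funext ξ
    rw [hf]
    simp only [m]
    ring
  have hlow := packet_integral_lower (n := n) hk (fun _ => b.nonneg) hl₀ hk0 hR0 ha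
    (g := fun w : Space n × ℝ => m (lightcone (R * w.2) w.1) *
      Complex.exp (-(Complex.I * ((t₀ * ‖lightcone (R * w.2) w.1‖ : ℝ) : ℂ)))) (B := B) (v := ψ r₀)
    ?_ ?_ ?_
  · rw [hval, integral_mul_packetHat hk hl₀ hk0 hR0 ha t₀ hmm hmB, norm_mul, Complex.norm_real,
      Real.norm_of_nonneg (by positivity), mul_assoc]
    refine mul_le_mul_of_nonneg_left ?_ (by positivity)
    refine le_trans (le_of_eq ?_) hlow
    rw [Real.mul_rpow (x := 2 * Real.pi) (by positivity) (by positivity)]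
    ring
  · have h1 : Measurable fun w : Space n × ℝ => lightcone (R * w.2) w.1 :=
      measurable_lightcone.comp (f := fun w : Space n × ℝ => (w.1, R * w.2)) (by fun_prop)
    exact (hmm.comp h1).mul (by fun_prop)
  · intro w
    rw [norm_mul, ← mul_neg, ← Complex.ofReal_neg, Complex.norm_exp_I_mul_ofReal, mul_one]
    exact hmB _
  · intro s hs y
    have hs0 : 0 < s := hl₀.trans_le hs.1
    have h1 := norm_symbol_sub_le (n := n) hL hL0 hR0 hM0 hRℓ ht hε0.le (min_le_left _ _) hs0
      (Λ := 3 * r₀) (ε' := ε')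
      (by have : ε' ≤ r₀ / 2 := min_le_left _ _
          linarith [hs.2])
      (by rw [abs_le]; constructor <;> linarith [hs.1, hs.2]) hx0 hx y
    refine h1.trans ?_
    rw [div_eq_mul_one_div |ψ r₀|]
    exact mul_le_mul_of_nonneg_right hconst (by positivity)

/-- The volume of a box around the center of a wave packet. -/
theorem volume_box {n : ℕ} (c α β : ℝ) (hα : 0 ≤ α) (hβ : 0 ≤ β) :
    volume {x : Space (n + 1) | |x 0 + c| ≤ α ∧ ‖transverse x‖ ≤ β} =
      ENNReal.ofReal (2 * α * (β ^ n * (volume (Metric.ball (0 : Space n) 1)).toReal)) := by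
  have h1 : {x : Space (n + 1) | |x 0 + c| ≤ α ∧ ‖transverse x‖ ≤ β} =
      splitEquiv n ⁻¹' (Icc (-c - α) (-c + α) ×ˢ Metric.closedBall (0 : Space n) β) := by
    ext x
    simp only [mem_ofPred_eq, mem_preimage, splitEquiv_apply, mem_prod, mem_Icc,
      Metric.mem_closedBall, dist_zero_right, abs_le]
    constructor
    · rintro ⟨⟨h1, h2⟩, h3⟩
      exact ⟨⟨by linarith, by linarith⟩, h3⟩
    · rintro ⟨⟨h1, h2⟩, h3⟩
      exact ⟨⟨by linarith, by linarith⟩, h3⟩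
  rw [h1, (measurePreserving_splitEquiv n).measure_preimage_equiv, Measure.volume_eq_prod,
    Measure.prod_prod, Real.volume_Icc, Measure.addHaar_closedBall _ _ hβ,
    finrank_euclideanSpace_fin, ENNReal.ofReal_mul (p := 2 * α) (by positivity),
    ENNReal.ofReal_mul (p := β ^ n) (by positivity), ENNReal.ofReal_toReal measure_ball_lt_top.ne]
  congr 2
  ring

/-! ### Homogeneity and lower bounds for the mixed norms. -/

theorem halfWaveLoc_const_smul {d : ℕ} (ψ : ℝ → ℝ) (j : ℕ) (t : ℝ) (c : ℂ) (f : Space d → ℂ) :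
    halfWaveLoc ψ j t (c • f) = c • halfWaveLoc ψ j t f := by
  have h1 : ∀ ξ, fourierHat (c • f) ξ = c * fourierHat f ξ := by
    intro ξ
    unfold fourierHat
    rw [← integral_const_mul]
    congr 1
    funext y
    simp only [Pi.smul_apply, smul_eq_mul]
    ring
  funext x
  simp only [Pi.smul_apply, smul_eq_mul]
  unfold halfWaveLoc multiplierOp
  rw [mul_left_comm, ← integral_const_mul c]
  congr 2
  funext ξ
  rw [h1]
  ring

theorem mixedNorm_const_smul {d : ℕ} {q : ℝ} (hq : 0 < q) (F : Finset ℝ) (ψ : ℝ → ℝ) (j : ℕ)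
    (c : ℂ) (f : Space d → ℂ) :
    mixedNorm q F (halfWaveLoc ψ j) (c • f) = ‖c‖ₑ * mixedNorm q F (halfWaveLoc ψ j) f := by
  unfold mixedNorm
  simp_rw [halfWaveLoc_const_smul, eLpNorm_const_smul, ENNReal.mul_rpow_of_nonneg _ _ hq.le]
  rw [← Finset.mul_sum, ENNReal.mul_rpow_of_nonneg _ _ (by positivity), ← ENNReal.rpow_mul,
    mul_one_div_cancel hq.ne', ENNReal.rpow_one]

theorem le_opNorm_of_eLpNorm_le {d : ℕ} {p q : ℝ} (hq : 0 < q) (F : Finset ℝ) (ψ : ℝ → ℝ) (j : ℕ)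
    (f : 𝓢(Space d, ℂ)) {D : ℝ} (hD : 0 < D)
    (hf : eLpNorm f (ENNReal.ofReal p) volume ≤ ENNReal.ofReal D) :
    ENNReal.ofReal D⁻¹ * mixedNorm q F (halfWaveLoc ψ j) f ≤
      opNorm (d := d) p q F (halfWaveLoc ψ j) := by
  have hnorm : ‖((D⁻¹ : ℝ) : ℂ)‖ₑ = ENNReal.ofReal D⁻¹ := by
    rw [← ofReal_norm, Complex.norm_real, Real.norm_of_nonneg (by positivity)]
  have hcoe : ⇑(((D⁻¹ : ℝ) : ℂ) • f) = ((D⁻¹ : ℝ) : ℂ) • ⇑f := rfl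
  unfold opNorm
  refine le_trans (le_of_eq ?_) (le_iSup₂ (f := fun (g : 𝓢(Space d, ℂ))
    (_ : eLpNorm (⇑g) (ENNReal.ofReal p) volume ≤ 1) => mixedNorm q F (halfWaveLoc ψ j) ⇑g)
    (((D⁻¹ : ℝ) : ℂ) • f) ?_)
  · rw [hcoe, mixedNorm_const_smul hq, hnorm]
  · rw [hcoe, eLpNorm_const_smul, hnorm]
    calc _ ≤ ENNReal.ofReal D⁻¹ * ENNReal.ofReal D := by gcongr
      _ = 1 := by
        rw [← ENNReal.ofReal_mul (by positivity), inv_mul_cancel₀ hD.ne', ENNReal.ofReal_one]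

theorem mixedNorm_ge {d : ℕ} {q : ℝ} (hq : 0 < q) {F F' : Finset ℝ} (hF : F' ⊆ F)
    (T : ℝ → (Space d → ℂ) → Space d → ℂ) (f : Space d → ℂ) {A v : ℝ} (hA : 0 ≤ A) (hv : 0 ≤ v)
    (S : ℝ → Set (Space d)) (hS : ∀ t, MeasurableSet (S t))
    (hvol : ∀ t, volume (S t) = ENNReal.ofReal v)
    (hT : ∀ t ∈ F', ∀ x ∈ S t, A ≤ ‖T t f x‖) :
    ENNReal.ofReal ((F'.card : ℝ) ^ (1 / q) * (A * v ^ (1 / q))) ≤ mixedNorm q F T f := by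
  unfold mixedNorm
  have h1 : ∀ t ∈ F', ENNReal.ofReal (A ^ q * v) ≤
      eLpNorm (T t f) (ENNReal.ofReal q) volume ^ q := by
    intro t ht
    rw [eLpNorm_eq_lintegral_rpow_enorm_toReal (by simpa using hq) ENNReal.ofReal_ne_top,
      ENNReal.toReal_ofReal hq.le, ← ENNReal.rpow_mul, one_div_mul_cancel hq.ne', ENNReal.rpow_one]
    calc ENNReal.ofReal (A ^ q * v) = ∫⁻ _ in S t, ENNReal.ofReal (A ^ q) := by
          rw [setLIntegral_const, hvol, ENNReal.ofReal_mul (by positivity)]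
      _ ≤ ∫⁻ x in S t, ‖T t f x‖ₑ ^ q := by
          refine setLIntegral_mono' (hS t) fun x hx => ?_
          rw [← ENNReal.ofReal_rpow_of_nonneg hA hq.le]
          gcongr
          rw [← ofReal_norm]
          exact ENNReal.ofReal_le_ofReal (hT t ht x hx)
      _ ≤ _ := setLIntegral_le_lintegral _ _
  calc _ = (ENNReal.ofReal ((F'.card : ℝ) * (A ^ q * v))) ^ (1 / q) := by
        rw [ENNReal.ofReal_rpow_of_nonneg (by positivity) (by positivity),
          Real.mul_rpow (by positivity) (by positivity), Real.mul_rpow (by positivity) hv,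
          ← Real.rpow_mul hA, mul_one_div_cancel hq.ne', Real.rpow_one]
    _ = (∑ _t ∈ F', ENNReal.ofReal (A ^ q * v)) ^ (1 / q) := by
        rw [Finset.sum_const, nsmul_eq_mul, ENNReal.ofReal_mul (by positivity),
          ENNReal.ofReal_natCast]
    _ ≤ (∑ t ∈ F', eLpNorm (T t f) (ENNReal.ofReal q) volume ^ q) ^ (1 / q) := by
        gcongr with t ht
        exact h1 t ht
    _ ≤ _ := by
        gcongr

/-! ### Covering numbers and discretizations -/

/-- A point of E farther than δ from all of F could be adjoined to F, against maximality. -/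
theorem IsDiscretization.exists_near {E : Set ℝ} {δ : ℝ} (hδ : 0 < δ) {F : Finset ℝ}
    (hF : IsDiscretization E δ F) {x : ℝ} (hx : x ∈ E) : ∃ t ∈ F, |x - t| ≤ δ := by
  by_contra hcon
  push Not at hcon
  obtain ⟨⟨h1, h2⟩, h3⟩ := hF
  have hmem : x ∈ (F : Set ℝ) := by
    refine h3 (y := insert x (F : Set ℝ)) ⟨insert_subset hx h1, ?_⟩ (subset_insert _ _)
      (mem_insert _ _)
    refine Set.pairwise_insert.2 ⟨h2, fun b hb _ => ⟨(hcon b hb).le, ?_⟩⟩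
    rw [abs_sub_comm]
    exact (hcon b hb).le
  have := hcon x hmem
  simp at this
  linarith

/-- The interval [t - δ, t + δ] is the union of two intervals of length δ, centered at t ± δ/2. -/
theorem externalCoveringNumber_le_two_mul_card {A : Set ℝ} {δ : ℝ} {F : Finset ℝ}
    (hA : ∀ x ∈ A, ∃ t ∈ F, |x - t| ≤ δ) :
    Metric.externalCoveringNumber (δ / 2).toNNReal A ≤ ((2 * F.card : ℕ) : ℕ∞) := by
  classical
  let C : Finset ℝ := F.image (fun t => t - δ / 2) ∪ F.image (fun t => t + δ / 2)
  have hcov : Metric.IsCover (δ / 2).toNNReal A (C : Set ℝ) := by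
    intro x hx
    obtain ⟨t, ht, hxt⟩ := hA x hx
    rw [abs_le] at hxt
    rcases le_total x t with h | h
    · refine ⟨t - δ / 2, ?_, ?_⟩
      · simp only [C, Finset.coe_union, Finset.coe_image]
        exact Or.inl ⟨t, ht, rfl⟩
      · change edist x (t - δ / 2) ≤ _
        rw [edist_dist, Real.dist_eq]
        exact ENNReal.ofReal_le_ofReal (by rw [abs_le]; constructor <;> linarith)
    · refine ⟨t + δ / 2, ?_, ?_⟩
      · simp only [C, Finset.coe_union, Finset.coe_image]
        exact Or.inr ⟨t, ht, rfl⟩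
      · change edist x (t + δ / 2) ≤ _
        rw [edist_dist, Real.dist_eq]
        exact ENNReal.ofReal_le_ofReal (by rw [abs_le]; constructor <;> linarith)
  have h1 := hcov.externalCoveringNumber_le_encard
  rw [Set.encard_coe_eq_coe_finsetCard] at h1
  have h2 : C.card ≤ 2 * F.card := by
    refine (Finset.card_union_le _ _).trans ?_
    have := Finset.card_image_le (s := F) (f := fun t => t - δ / 2)
    have := Finset.card_image_le (s := F) (f := fun t => t + δ / 2)
    omega
  exact h1.trans (by exact_mod_cast h2)

theorem coverN_le_two_mul_card {A : Set ℝ} {δ : ℝ} {F : Finset ℝ}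
    (hA : ∀ x ∈ A, ∃ t ∈ F, |x - t| ≤ δ) : coverN A δ ≤ 2 * F.card :=
  ENat.toNat_le_of_le_natCast (externalCoveringNumber_le_two_mul_card hA)

/-- `toNat` sends ∞ to 0, so monotonicity needs a finite covering number at the finer scale; F
supplies it. -/
theorem coverN_anti {A : Set ℝ} {δ δ' : ℝ} (hδ : δ ≤ δ') {F : Finset ℝ}
    (hA : ∀ x ∈ A, ∃ t ∈ F, |x - t| ≤ δ) : coverN A δ' ≤ coverN A δ := by
  refine ENat.toNat_le_toNat (Metric.externalCoveringNumber_anti ?_) ?_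
  · exact Real.toNNReal_le_toNNReal (by linarith)
  · exact ne_top_of_le_ne_top (ENat.natCast_ne_top _) (externalCoveringNumber_le_two_mul_card hA)

theorem one_le_coverN {A : Set ℝ} (hne : A.Nonempty) {δ : ℝ} {F : Finset ℝ}
    (hA : ∀ x ∈ A, ∃ t ∈ F, |x - t| ≤ δ) : 1 ≤ coverN A δ := by
  have h1 : Metric.externalCoveringNumber (δ / 2).toNNReal A ≠ ⊤ :=
    ne_top_of_le_ne_top (ENat.natCast_ne_top _) (externalCoveringNumber_le_two_mul_card hA)
  have h2 : 0 < Metric.externalCoveringNumber (δ / 2).toNNReal A :=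
    Metric.externalCoveringNumber_pos_iff.2 hne
  unfold coverN
  rw [Nat.one_le_iff_ne_zero]
  intro h
  rcases ENat.toNat_eq_zero.1 h with h | h
  · exact h2.ne' h
  · exact h1 h


/-! ### The lower bound -/

/-- Exponent bookkeeping with x = 1/p and y = 1/q: inverse `L^p` size of the packet, times its
focused height, times the box volume to the power 1/q. Taking logarithms makes it a linear identity.
-/
theorem packet_ratio_eq {R a : ℝ} (hR : 0 < R) (ha : 0 < a) (n x y : ℝ) :
    (R ^ (n / 2) * (R⁻¹ * ((R * a) ^ (n / 2))⁻¹) ^ x)⁻¹ *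
        ((R / a) ^ (n / 2) * (R⁻¹ * (a / R) ^ (n / 2)) ^ y) =
      R ^ ((n + 2) / 2 * (x - y)) * a ^ (-(n / 2 * (1 - x - y))) := by
  apply Real.log_injOn_pos (mem_Ioi.2 (by positivity)) (mem_Ioi.2 (by positivity))
  have hRa : 0 < (R * a) ^ (n / 2) := by positivity
  have haR : 0 < (a / R) ^ (n / 2) := by positivity
  have hRi : 0 < R⁻¹ := by positivity
  have h1 : 0 < R⁻¹ * ((R * a) ^ (n / 2))⁻¹ := by positivity
  have h2 : 0 < R⁻¹ * (a / R) ^ (n / 2) := by positivity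
  rw [Real.log_mul (by positivity) (by positivity), Real.log_inv,
    Real.log_mul (by positivity) (by positivity), Real.log_mul (by positivity) (by positivity),
    Real.log_mul (by positivity) (by positivity), Real.log_rpow hR, Real.log_rpow h1,
    Real.log_rpow (by positivity), Real.log_rpow h2, Real.log_mul hRi.ne' (by positivity),
    Real.log_mul hRi.ne' haR.ne', Real.log_inv, Real.log_inv, Real.log_rpow (by positivity),
    Real.log_rpow (by positivity), Real.log_rpow hR, Real.log_rpow ha,
    Real.log_mul hR.ne' ha.ne', Real.log_div hR.ne' ha.ne', Real.log_div ha.ne' hR.ne']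
  ring

theorem lowerQuantity_nonneg {d : ℕ} {p q : ℝ} {E : Set ℝ} {j : ℕ} {I : Set ℝ} {ℓ : ℝ}
    (hℓ : 0 ≤ ℓ) : 0 ≤ lowerQuantity d p q E j I ℓ := by
  unfold lowerQuantity
  positivity

/-- The lower bound for localized propagators whose symbol `ψ` is bounded and Lipschitz. -/
theorem lowerQuantity_le_opNorm (n : ℕ) {ψ : ℝ → ℝ} (hψ : Continuous ψ) {B : ℝ}
    (hB : ∀ s, |ψ s| ≤ B) {L r₀ : ℝ} (hL0 : 0 ≤ L) (hL : ∀ s, |ψ s - ψ r₀| ≤ L * |s - r₀|)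
    (hr₀ : 0 < r₀) (hne : ψ r₀ ≠ 0) {q : ℝ} (hq : 0 < q) :
    ∃ c : ℝ, 0 < c ∧ ∀ p : ℝ, 1 ≤ p → ∀ E : Set ℝ, E ⊆ Icc 1 2 → ∀ (j : ℕ) (F : Finset ℝ),
      IsDiscretization E ((2 : ℝ) ^ j)⁻¹ F → ∀ (I : Set ℝ) (ℓ : ℝ), IsIntervalOfLength I ℓ →
        1 ≤ (2 : ℝ) ^ j * ℓ → ℓ ≤ 1 →
        ENNReal.ofReal (c * lowerQuantity (n + 1) p q E j I ℓ)
            ≤ opNorm (d := n + 1) p q F (halfWaveLoc ψ j) := by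
  obtain ⟨k, l₀, l₁, M, ε, c₁, hk, hl₀, hk0, hM, hε, hc₁, hlow⟩ :=
    exists_packet_lower n hψ hB hL0 hL hr₀ hne
  have hM0 : 0 < M := by linarith
  obtain ⟨C, hC, hup⟩ := exists_packet (n := n) hk hl₀ hk0 hM0
  set ball₁ := (volume (Metric.ball (0 : Space n) 1)).toReal with hball
  have hball0 : 0 < ball₁ := ENNReal.toReal_pos (Metric.measure_ball_pos _ _ one_pos).ne'
    measure_ball_lt_top.ne
  set V : ℝ := 2 * ε * (ε ^ n * ball₁) with hV
  have hV0 : 0 < V := by positivity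
  refine ⟨C⁻¹ * c₁ * V ^ (1 / q) * (2⁻¹ : ℝ) ^ (1 / q) * (M ^ ((n : ℝ) / 2))⁻¹, by positivity, ?_⟩
  intro p hp E hE j F hF I ℓ hI hRℓ hℓ1
  set R : ℝ := 2 ^ j with hR
  have hR1 : 1 ≤ R := one_le_pow₀ (by norm_num)
  have hR0 : 0 < R := by positivity
  have hℓ : 0 < ℓ := by
    by_contra h
    push Not at h
    nlinarith
  have hδ : R⁻¹ ≤ ℓ := by rw [inv_le_iff_one_le_mul₀ hR0]; linarith
  by_cases hEI : (E ∩ I).Nonempty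
  swap
  · rw [not_nonempty_iff_eq_empty] at hEI
    have : coverN (E ∩ I) R⁻¹ = 0 := by simp [coverN, hEI]
    have h0 : lowerQuantity (n + 1) p q E j I ℓ = 0 := by
      rw [lowerQuantity, ← hR, this]
      simp [Real.zero_rpow, hq.ne']
    rw [h0]; simp
  obtain ⟨e, heE, heI⟩ := hEI
  obtain ⟨t₀, ht₀F, ht₀⟩ := hF.exists_near (by positivity) heE
  obtain ⟨b, -, hIb⟩ := hI
  have ht₀E := hE (hF.1.1 ht₀F)
  -- 3ℓ = ℓ + 2ℓ: two points of I differ by at most ℓ, and each is within 2^{-j} ≤ ℓ of its nearest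
  -- point in F.
  set F' := F.filter fun t => |t - t₀| ≤ 3 * ℓ with hF'
  have hcov : ∀ x ∈ E ∩ I, ∃ t ∈ F', |x - t| ≤ R⁻¹ := by
    rintro x ⟨hxE, hxI⟩
    obtain ⟨t, htF, hxt⟩ := hF.exists_near (by positivity) hxE
    refine ⟨t, Finset.mem_filter.2 ⟨htF, ?_⟩, hxt⟩
    have h1 := hIb hxI
    have h2 := hIb heI
    rw [abs_le] at hxt ht₀ ⊢
    constructor <;> linarith [h1.1, h1.2, h2.1, h2.2]
  have hN : (coverN (E ∩ I) R⁻¹ : ℝ) ≤ 2 * F'.card := by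
    exact_mod_cast coverN_le_two_mul_card hcov
  set a : ℝ := M * ℓ with ha
  have ha0 : 0 < a := by positivity
  have haM : a ≤ M := mul_le_of_le_one_right hM0.le hℓ1
  have hRa : 1 ≤ R * a := by
    rw [ha]; nlinarith
  obtain ⟨f, hf, hfp⟩ := hup R a t₀ hR1 ha0 haM hRa ht₀E.1 ht₀E.2
  set D : ℝ := C * R ^ ((n : ℝ) / 2) * (R⁻¹ * ((R * a) ^ ((n : ℝ) / 2))⁻¹) ^ (1 / p) with hD
  have hD0 : 0 < D := by positivity
  have hop := le_opNorm_of_eLpNorm_le hq F ψ j f hD0 (hfp p hp)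
  refine le_trans ?_ hop
  have hβ : √(a / R) ^ n = (a / R) ^ ((n : ℝ) / 2) := by
    rw [Real.sqrt_eq_rpow, ← Real.rpow_natCast, ← Real.rpow_mul (by positivity)]
    congr 1
    ring
  have hmix := mixedNorm_ge hq (Finset.filter_subset _ _ : F' ⊆ F) (halfWaveLoc ψ j) f
    (A := c₁ * (R / a) ^ ((n : ℝ) / 2)) (v := V * (R⁻¹ * (a / R) ^ ((n : ℝ) / 2)))
    (by positivity) (by positivity)
    (fun t => {x : Space (n + 1) | |x 0 + (t - t₀)| ≤ ε / R ∧ ‖transverse x‖ ≤ ε * √(a / R)})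
    (fun t => by
      have h1 : Measurable fun x : Space (n + 1) => (x 0, transverse x) :=
        (splitEquiv n).measurable
      have h2 : Measurable fun x : Space (n + 1) => x 0 := h1.fst
      have h3 : Measurable fun x : Space (n + 1) => transverse x := h1.snd
      exact (measurableSet_le (continuous_abs.measurable.comp (h2.add_const (t - t₀)))
        measurable_const).inter
        (measurableSet_le h3.norm measurable_const))
    (fun t => by
      rw [volume_box _ _ _ (by positivity) (by positivity), mul_pow, hβ, hV]
      congr 1
      ring)
    (fun t ht x hx => by
      refine hlow j ℓ t t₀ f hRℓ (Finset.mem_filter.1 ht).2 hf x ?_ ?_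
      · rw [add_sub_assoc]; exact hx.1
      · have h1 : ‖transverse x‖ ^ 2 ≤ (ε * √(a / R)) ^ 2 :=
          pow_le_pow_left₀ (norm_nonneg _) hx.2 2
        rwa [mul_pow, Real.sq_sqrt (by positivity)] at h1)
  calc _ ≤ ENNReal.ofReal (D⁻¹ * ((F'.card : ℝ) ^ (1 / q) * (c₁ * (R / a) ^ ((n : ℝ) / 2) *
        (V * (R⁻¹ * (a / R) ^ ((n : ℝ) / 2))) ^ (1 / q)))) := by
        apply ENNReal.ofReal_le_ofReal
        have hid := packet_ratio_eq hR0 ha0 n (1 / p) (1 / q)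
        have hrhs : D⁻¹ * ((F'.card : ℝ) ^ (1 / q) * (c₁ * (R / a) ^ ((n : ℝ) / 2) *
            (V * (R⁻¹ * (a / R) ^ ((n : ℝ) / 2))) ^ (1 / q))) =
            C⁻¹ * c₁ * V ^ (1 / q) * (F'.card : ℝ) ^ (1 / q) *
              (R ^ (((n : ℝ) + 2) / 2 * (1 / p - 1 / q)) *
                a ^ (-((n : ℝ) / 2 * (1 - 1 / p - 1 / q)))) := by
          rw [← hid, hD, Real.mul_rpow hV0.le (by positivity), mul_assoc C, mul_inv C]
          ring
        rw [hrhs]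
        set θ : ℝ := (n : ℝ) / 2 * (1 - 1 / p - 1 / q) with hθ
        have hlq : lowerQuantity (n + 1) p q E j I ℓ =
            (coverN (E ∩ I) R⁻¹ : ℝ) ^ (1 / q) *
              (R ^ (((n : ℝ) + 2) / 2 * (1 / p - 1 / q)) * ℓ ^ (-θ)) := by
          unfold lowerQuantity
          rw [← hR, Real.rpow_neg hℓ.le, hR, ← Real.rpow_natCast 2 j, ← Real.rpow_mul (by norm_num)]
          have e1 : ((n + 1 : ℕ) : ℝ) = (n : ℝ) + 1 := by push_cast; ring
          rw [e1, show ((n : ℝ) + 1 - 1) / 2 * (1 - 1 / p - 1 / q) = θ by rw [hθ]; ring,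
            show (j : ℝ) * (((n : ℝ) + 1 + 1) / 2) * (1 / p - 1 / q) =
              (j : ℝ) * (((n : ℝ) + 2) / 2 * (1 / p - 1 / q)) by ring]
          rw [div_eq_mul_inv, mul_assoc]
        have hcard : (2⁻¹ : ℝ) ^ (1 / q) * (coverN (E ∩ I) R⁻¹ : ℝ) ^ (1 / q) ≤
            (F'.card : ℝ) ^ (1 / q) := by
          rw [← Real.mul_rpow (by norm_num) (by positivity)]
          gcongr
          linarith
        -- θ ≤ n/2 and M ≥ 1, so the loss M^(-θ) is bounded below uniformly in p.
        have haθ : (M ^ ((n : ℝ) / 2))⁻¹ * ℓ ^ (-θ) ≤ a ^ (-θ) := by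
          rw [ha, Real.mul_rpow hM0.le hℓ.le, ← Real.rpow_neg hM0.le]
          gcongr
          rw [hθ]
          have h1 : 0 ≤ 1 / p := by positivity
          have h2 : 0 ≤ 1 / q := by positivity
          have h3 : (0 : ℝ) ≤ (n : ℝ) / 2 := by positivity
          nlinarith
        rw [hlq]
        calc _ = C⁻¹ * c₁ * V ^ (1 / q) *
              ((2⁻¹ : ℝ) ^ (1 / q) * (coverN (E ∩ I) R⁻¹ : ℝ) ^ (1 / q)) *
              (R ^ (((n : ℝ) + 2) / 2 * (1 / p - 1 / q)) *
                ((M ^ ((n : ℝ) / 2))⁻¹ * ℓ ^ (-θ))) := by ring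
          _ ≤ _ := by gcongr
    _ ≤ _ := by
        rw [ENNReal.ofReal_mul (by positivity)]
        gcongr


/-! ### Sharpness of the exponents -/

/-- For 2^{-(m+1)} < δ ≤ 2^{-m}, pass to the finer dyadic scale at the cost of a factor 2^{|σ|}. The
constant disappears after division by log(1/δ) → ∞. A unit interval starting at a point of E keeps
the supremum at least 1, so the quotients are bounded below and the limsup is a genuine one. -/
theorem legendreAssouad_le {E : Set ℝ} (hne : E.Nonempty) {Ej : ℕ → Finset ℝ}
    (hEj : ∀ j : ℕ, IsDiscretization E ((2 : ℝ) ^ j)⁻¹ (Ej j)) {α σ C : ℝ} (hC : 0 < C)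
    (h : ∀ (j : ℕ) (I : Set ℝ) (ℓ : ℝ), 1 ≤ j → IsIntervalOfLength I ℓ → 1 ≤ (2 : ℝ) ^ j * ℓ →
      ℓ ≤ 1 → ℓ ^ (-α) * (coverN (E ∩ I) ((2 : ℝ) ^ j)⁻¹ : ℝ) ≤ C * ((2 : ℝ) ^ j) ^ σ) :
    legendreAssouad E α ≤ σ := by
  obtain ⟨e, he⟩ := hne
  set C' : ℝ := C * 2 ^ |σ| with hC'
  have hC'0 : 0 < C' := by positivity
  have key : ∀ δ : ℝ, 0 < δ → δ < 1 → ∀ S : Set ℝ,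
      S = {y : ℝ | ∃ (I : Set ℝ) (ℓ : ℝ), IsIntervalOfLength I ℓ ∧ δ ≤ ℓ ∧ ℓ ≤ 1 ∧
        y = ℓ ^ (-α) * (coverN (E ∩ I) δ : ℝ)} →
      1 ≤ sSup S ∧ sSup S ≤ C' * (1 / δ) ^ σ := by
    intro δ hδ hδ1 S hS
    obtain ⟨m, hm1, hm2⟩ := exists_nat_pow_near_of_lt_one hδ hδ1.le (y := (1 / 2 : ℝ))
      (by norm_num) (by norm_num)
    have hjδ : ((2 : ℝ) ^ (m + 1))⁻¹ ≤ δ := by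
      rw [one_div, inv_pow] at hm1
      exact hm1.le
    have hcov : ∀ I : Set ℝ, ∀ x ∈ E ∩ I, ∃ t ∈ Ej (m + 1), |x - t| ≤ ((2 : ℝ) ^ (m + 1))⁻¹ :=
      fun I x hx => (hEj (m + 1)).exists_near (by positivity) hx.1
    have hcov' : ∀ I : Set ℝ, ∀ x ∈ E ∩ I, ∃ t ∈ Ej (m + 1), |x - t| ≤ δ := fun I x hx => by
      obtain ⟨t, ht, hxt⟩ := hcov I x hx
      exact ⟨t, ht, hxt.trans hjδ⟩
    have hpow : ((2 : ℝ) ^ (m + 1)) ^ σ ≤ 2 ^ |σ| * (1 / δ) ^ σ := by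
      set κ : ℝ := 2 ^ (m + 1) * δ with hκ
      have hκ0 : 0 < κ := by positivity
      have hκ1 : 1 ≤ κ := by
        rw [inv_le_iff_one_le_mul₀ (by positivity)] at hjδ
        linarith
      have hκ2 : κ ≤ 2 := by
        rw [one_div, inv_pow] at hm2
        have h1 : (2 : ℝ) ^ m * δ ≤ 2 ^ m * ((2 : ℝ) ^ m)⁻¹ := by gcongr
        rw [mul_inv_cancel₀ (by positivity)] at h1
        rw [hκ, pow_succ]
        linarith
      have h2 : (2 : ℝ) ^ (m + 1) = κ * (1 / δ) := by rw [hκ]; field_simp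
      rw [h2, Real.mul_rpow hκ0.le (by positivity)]
      gcongr
      calc κ ^ σ ≤ κ ^ |σ| := Real.rpow_le_rpow_of_exponent_le hκ1 (le_abs_self _)
        _ ≤ 2 ^ |σ| := by gcongr
    have hub : ∀ y ∈ S, y ≤ C' * (1 / δ) ^ σ := by
      intro y hy
      rw [hS] at hy
      obtain ⟨I, ℓ, hI, hℓ, hℓ1, rfl⟩ := hy
      have hℓ0 : 0 < ℓ := hδ.trans_le hℓ
      calc ℓ ^ (-α) * (coverN (E ∩ I) δ : ℝ)
          ≤ ℓ ^ (-α) * (coverN (E ∩ I) ((2 : ℝ) ^ (m + 1))⁻¹ : ℝ) := by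
            gcongr
            exact coverN_anti hjδ (hcov I)
        _ ≤ C * ((2 : ℝ) ^ (m + 1)) ^ σ := h (m + 1) I ℓ (by omega) hI
            (by rw [← inv_le_iff_one_le_mul₀' (by positivity)]; exact hjδ.trans hℓ) hℓ1
        _ ≤ C * (2 ^ |σ| * (1 / δ) ^ σ) := by gcongr
        _ = _ := by rw [hC']; ring
    have hmem : (coverN (E ∩ Icc e (e + 1)) δ : ℝ) ∈ S := by
      rw [hS]
      exact ⟨Icc e (e + 1), 1, ⟨e, Ioo_subset_Icc_self, subset_rfl⟩, hδ1.le, le_rfl,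
        by rw [Real.one_rpow, one_mul]⟩
    have hone : (1 : ℝ) ≤ coverN (E ∩ Icc e (e + 1)) δ := by
      have hne' : (E ∩ Icc e (e + 1)).Nonempty := ⟨e, he, by constructor <;> linarith⟩
      exact_mod_cast one_le_coverN hne' (hcov' _)
    exact ⟨hone.trans (le_csSup ⟨_, hub⟩ hmem), csSup_le ⟨_, hmem⟩ hub⟩
  unfold legendreAssouad
  have hev : ∀ᶠ δ : ℝ in 𝓝[>] 0, 0 < δ ∧ δ < 1 := by
    filter_upwards [Ioo_mem_nhdsGT (one_pos : (0 : ℝ) < 1)] with δ hδ using hδ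
  refine le_of_forall_pos_le_add fun η hη => ?_
  refine limsup_le_of_le ?_ ?_
  · refine isCoboundedUnder_le_of_eventually_le _ (x := 0) ?_
    filter_upwards [hev] with δ hδ
    obtain ⟨h1, -⟩ := key δ hδ.1 hδ.2 _ rfl
    refine div_nonneg (Real.log_nonneg h1) (Real.log_nonneg ?_)
    rw [le_div_iff₀ hδ.1]
    linarith [hδ.2]
  · have hlog : Tendsto (fun δ : ℝ => Real.log (1 / δ)) (𝓝[>] 0) atTop := by
      simp only [one_div]
      exact Real.tendsto_log_atTop.comp tendsto_inv_nhdsGT_zero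
    filter_upwards [hev, hlog.eventually_ge_atTop (Real.log C' / η),
      hlog.eventually_gt_atTop 0] with δ hδ hlarge hpos
    obtain ⟨h1, h2⟩ := key δ hδ.1 hδ.2 _ rfl
    rw [div_le_iff₀ hpos]
    have hδi : 0 < 1 / δ := by have := hδ.1; positivity
    calc _ ≤ Real.log (C' * (1 / δ) ^ σ) := Real.log_le_log (by linarith) h2
      _ = Real.log C' + σ * Real.log (1 / δ) := by
          rw [Real.log_mul hC'0.ne' (Real.rpow_pos_of_pos hδi _).ne', Real.log_rpow hδi]
      _ ≤ _ := by
          rw [div_le_iff₀ hη] at hlarge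
          linarith

/-- The estimate bounds `opNorm` by a constant times 2^{js}. Comparing with the lower bound and
raising to the power q gives the hypothesis of `legendreAssouad_le` with σ = q(s - e). -/
theorem criticalExponent_le_of_smoothingEstimate {n : ℕ} {φ : ℝ → ℝ} {p q s : ℝ}
    (hq : 0 < q) {c : ℝ} (hc : 0 < c) {E : Set ℝ} (hne : E.Nonempty) {Ej : ℕ → Finset ℝ}
    (hEj : ∀ j : ℕ, IsDiscretization E ((2 : ℝ) ^ j)⁻¹ (Ej j))
    (hlow : ∀ (j : ℕ) (I : Set ℝ) (ℓ : ℝ), IsIntervalOfLength I ℓ → 1 ≤ (2 : ℝ) ^ j * ℓ → ℓ ≤ 1 →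
      ENNReal.ofReal (c * lowerQuantity (n + 1) p q E j I ℓ)
        ≤ opNorm (d := n + 1) p q (Ej j) (halfWaveLoc φ j))
    (hS : SmoothingEstimate (n + 1) φ Ej p q s) : criticalExponent (n + 1) E p q ≤ s := by
  obtain ⟨C, hC⟩ := hS
  set e : ℝ := (((n + 1 : ℕ) : ℝ) + 1) / 2 * (1 / p - 1 / q) with he
  set κ : ℝ := (((n + 1 : ℕ) : ℝ) - 1) / 2 * (1 - 1 / p - 1 / q) with hκ
  have hν : legendreAssouad E (q * κ) ≤ q * (s - e) := by
    -- `max C 1` is used because the constant in the estimate is not assumed positive.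
    refine legendreAssouad_le hne hEj (C := ((max C 1) / c) ^ q) (by positivity) ?_
    intro j I ℓ hj hI hRℓ hℓ1
    set R : ℝ := 2 ^ j with hR
    have hR0 : 0 < R := by positivity
    have hℓ : 0 < ℓ := by
      by_contra h
      push Not at h
      nlinarith
    have h1 : opNorm (d := n + 1) p q (Ej j) (halfWaveLoc φ j) ≤
        ENNReal.ofReal (max C 1 * R ^ s) := by
      unfold opNorm
      refine iSup₂_le fun f hf => (hC j hj f).trans ?_
      rw [hR, ← Real.rpow_natCast, ← Real.rpow_mul (by norm_num)]
      calc _ ≤ ENNReal.ofReal (C * 2 ^ ((j : ℝ) * s)) * 1 := by gcongr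
        _ ≤ _ := by
          rw [mul_one]
          apply ENNReal.ofReal_le_ofReal
          gcongr
          exact le_max_left _ _
    have h2 := (hlow j I ℓ hI hRℓ hℓ1).trans h1
    rw [ENNReal.ofReal_le_ofReal_iff (by positivity)] at h2
    have h3 : lowerQuantity (n + 1) p q E j I ℓ =
        (coverN (E ∩ I) R⁻¹ : ℝ) ^ (1 / q) * R ^ e * ℓ ^ (-κ) := by
      unfold lowerQuantity
      rw [Real.rpow_neg hℓ.le, div_eq_mul_inv, mul_assoc (j : ℝ), Real.rpow_mul (by norm_num),
        Real.rpow_natCast]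
    rw [h3] at h2
    set N : ℝ := (coverN (E ∩ I) R⁻¹ : ℝ)
    have hN : 0 ≤ N := by positivity
    have h4 : N ^ (1 / q) * ℓ ^ (-κ) ≤ max C 1 / c * R ^ (s - e) := by
      rw [Real.rpow_sub hR0, div_mul_div_comm, le_div_iff₀ (by positivity)]
      linarith
    have h5 := Real.rpow_le_rpow (by positivity) h4 hq.le
    rw [Real.mul_rpow (by positivity) (by positivity), ← Real.rpow_mul hN,
      one_div_mul_cancel hq.ne', Real.rpow_one, Real.mul_rpow (by positivity) (by positivity),
      ← Real.rpow_mul hR0.le, ← Real.rpow_mul hℓ.le] at h5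
    rw [mul_comm _ N, show -(q * κ) = -κ * q by ring, mul_comm q (s - e)]
    exact h5
  unfold criticalExponent
  rw [← he, show q * (((n + 1 : ℕ) : ℝ) - 1) / 2 * (1 - 1 / p - 1 / q) = q * κ by rw [hκ]; ring]
  have : 1 / q * legendreAssouad E (q * κ) ≤ s - e := by
    rw [one_div, inv_mul_le_iff₀ hq]; exact hν
  linarith

/-! ### Time reversal and square functions -/

/-- The symbol is even in ξ and φ is real, so conjugation followed by ξ ↦ -ξ only changes the sign
of t. -/
theorem halfWaveLoc_neg_conj {d : ℕ} (φ : ℝ → ℝ) (j : ℕ) (t : ℝ) (f : Space d → ℂ) (x : Space d) :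
    halfWaveLoc φ j (-t) (fun y => starRingEnd ℂ (f y)) x =
      starRingEnd ℂ (halfWaveLoc φ j t f x) := by
  have hexp : ∀ r : ℝ, starRingEnd ℂ (Complex.exp (Complex.I * (r : ℂ))) =
      Complex.exp (Complex.I * ((-r : ℝ) : ℂ)) := by
    intro r
    rw [← Complex.exp_conj, map_mul, Complex.conj_I, Complex.conj_ofReal]
    congr 1
    push_cast
    ring
  have h1 : ∀ ξ, fourierHat (fun y => starRingEnd ℂ (f y)) (-ξ) =
      starRingEnd ℂ (fourierHat f ξ) := by
    intro ξ
    unfold fourierHat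
    rw [← integral_conj]
    congr 1
    funext y
    rw [map_mul, ← mul_neg, ← mul_neg, ← Complex.ofReal_neg, ← Complex.ofReal_neg, hexp,
      inner_neg_right]
  unfold halfWaveLoc multiplierOp
  rw [map_mul, Complex.conj_ofReal, ← integral_neg_eq_self, ← integral_conj]
  congr 2
  funext ξ
  beta_reduce
  rw [h1, norm_neg, map_mul, map_mul, map_mul, hexp, hexp, Complex.conj_ofReal, inner_neg_right,
    neg_mul]

/-- The embedding of ℓ^r in ℓ^q, from superadditivity of x ↦ x^(q/r) on x ≥ 0. -/
theorem sum_rpow_le_rpow_sum {ι : Type*} (F : Finset ι) (a : ι → ℝ) (ha : ∀ i, 0 ≤ a i) {r q : ℝ}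
    (hr : 0 < r) (hrq : r ≤ q) : ∑ i ∈ F, a i ^ q ≤ ((∑ i ∈ F, a i ^ r) ^ (1 / r)) ^ q := by
  classical
  have hqr : 1 ≤ q / r := by rw [le_div_iff₀ hr]; linarith
  have key : ∑ i ∈ F, (a i ^ r) ^ (q / r) ≤ (∑ i ∈ F, a i ^ r) ^ (q / r) := by
    induction F using Finset.induction_on with
    | empty => simp [Real.zero_rpow (show q / r ≠ 0 by linarith)]
    | insert i F hi ih =>
      rw [Finset.sum_insert hi, Finset.sum_insert hi]
      refine le_trans (by gcongr) (Real.add_rpow_le_rpow_add (Real.rpow_nonneg (ha i) _)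
        (Finset.sum_nonneg fun i _ => Real.rpow_nonneg (ha i) _) hqr)
  rw [← Real.rpow_mul (Finset.sum_nonneg fun i _ => Real.rpow_nonneg (ha i) _),
    one_div_mul_eq_div]
  refine le_trans (le_of_eq (Finset.sum_congr rfl fun i _ => ?_)) key
  rw [← Real.rpow_mul (ha i), mul_div_cancel₀ _ hr.ne']

/-- This direction holds for the lower integral with no measurability of g. -/
theorem sum_lintegral_le {α ι : Type*} [MeasurableSpace α] {μ : Measure α} (F : Finset ι)
    (g : ι → α → ℝ≥0∞) : ∑ i ∈ F, ∫⁻ x, g i x ∂μ ≤ ∫⁻ x, ∑ i ∈ F, g i x ∂μ := by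
  classical
  induction F using Finset.induction_on with
  | empty => simp
  | insert i F hi ih =>
    simp only [Finset.sum_insert hi]
    exact (add_le_add le_rfl ih).trans (le_lintegral_add _ _)

/-- Test the square function on the conjugate of f, which has the same `L^2` norm and reverses time;
then compare ℓ^q with ℓ^r pointwise in x. -/
theorem SquareFunctionEstimate.smoothingEstimate {d : ℕ} {φ : ℝ → ℝ} {Ej : ℕ → Finset ℝ}
    {r q s : ℝ} (hr : 0 < r) (hrq : r ≤ q) (h : SquareFunctionEstimate d φ Ej r q s) :
    SmoothingEstimate d φ Ej 2 q s := by
  have hq : 0 < q := hr.trans_le hrq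
  obtain ⟨C, hC⟩ := h
  refine ⟨C, fun j hj f => ?_⟩
  let g : 𝓢(Space d, ℂ) := SchwartzMap.postcompCLM (𝕜 := ℝ) (Complex.conjCLE : ℂ →L[ℝ] ℂ) f
  have hg : ⇑g = fun y => starRingEnd ℂ (f y) := rfl
  have hgnorm : eLpNorm (⇑g) 2 volume = eLpNorm (⇑f) (ENNReal.ofReal 2) volume := by
    rw [show ENNReal.ofReal 2 = 2 by simp]
    exact eLpNorm_congr_norm_ae (Eventually.of_forall fun x => by simp [hg])
  rw [← hgnorm]
  refine le_trans ?_ (hC j hj g)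
  have hT : ∀ t x, ‖halfWaveLoc φ j (-t) (⇑g) x‖ = ‖halfWaveLoc φ j t (⇑f) x‖ := by
    intro t x
    rw [hg, halfWaveLoc_neg_conj, RCLike.norm_conj]
  simp_rw [hT]
  unfold mixedNorm
  have hq' : ENNReal.ofReal q ≠ 0 := by simpa using hq
  simp_rw [eLpNorm_eq_lintegral_rpow_enorm_toReal hq' ENNReal.ofReal_ne_top,
    ENNReal.toReal_ofReal hq.le, ← ENNReal.rpow_mul, one_div_mul_cancel hq.ne', ENNReal.rpow_one]
  gcongr
  refine (sum_lintegral_le _ _).trans (lintegral_mono fun x => ?_)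
  have hpt := sum_rpow_le_rpow_sum (Ej j) (fun t => ‖halfWaveLoc φ j t (⇑f) x‖)
    (fun _ => norm_nonneg _) hr hrq
  have hnn : 0 ≤ (∑ t ∈ Ej j, ‖halfWaveLoc φ j t (⇑f) x‖ ^ r) ^ (1 / r) :=
    Real.rpow_nonneg (Finset.sum_nonneg fun i _ => Real.rpow_nonneg (norm_nonneg _) _) _
  have h2 := ENNReal.ofReal_le_ofReal hpt
  rw [ENNReal.ofReal_sum_of_nonneg fun i _ => Real.rpow_nonneg (norm_nonneg _) _,
    ← ENNReal.ofReal_rpow_of_nonneg hnn hq.le] at h2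
  rw [Real.enorm_of_nonneg hnn]
  refine le_trans (le_of_eq (Finset.sum_congr rfl fun t _ => ?_)) h2
  rw [← ofReal_norm, ENNReal.ofReal_rpow_of_nonneg (norm_nonneg _) hq.le]

theorem halfWaveLoc_one {d : ℕ} (j : ℕ) :
    halfWaveLoc (d := d) (fun _ => 1) j = halfWave := by
  funext t f
  unfold halfWaveLoc halfWave
  simp

end FractalWave
end

/-! ### Proof of the three statements. -/

theorem proposition4p1 (d : ℕ) (hd : 1 ≤ d) (φ : ℝ → ℝ) (hφ : ContDiff ℝ ∞ φ)
    (hφsupp : tsupport φ ⊆ Set.Ioo (1 / 4 : ℝ) 4) (hφne : ∃ r : ℝ, φ r ≠ 0) :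
    -- the lower bound; the condition `q > p'` reads `1/p + 1/q < 1`
    (∃ ρ₀ : ℝ, 0 < ρ₀ ∧ ρ₀ < 1 ∧ ∀ q : ℝ, 1 < q → ∃ c : ℝ, 0 < c ∧
      ∀ ρ : ℝ, 0 < ρ → ρ ≤ ρ₀ → ∀ p : ℝ, 1 ≤ p → 1 / p + 1 / q < 1 →
      ∀ E : Set ℝ, E ⊆ Set.Icc 1 2 → ∀ (j : ℕ) (F : Finset ℝ),
        FractalWave.IsDiscretization E ((2 : ℝ) ^ j)⁻¹ F →
      ∀ (I : Set ℝ) (ℓ : ℝ), FractalWave.IsIntervalOfLength I ℓ →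
        ρ⁻¹ ≤ (2 : ℝ) ^ j * ℓ → (2 : ℝ) ^ j * ℓ ≤ (2 : ℝ) ^ j →
        ENNReal.ofReal (c * ρ ^ ((d : ℝ) / q) * FractalWave.lowerQuantity d p q E j I ℓ)
            ≤ FractalWave.opNorm (d := d) p q F FractalWave.halfWave ∧
        ENNReal.ofReal (c * ρ ^ ((d : ℝ) / q) * FractalWave.lowerQuantity d p q E j I ℓ)
            ≤ FractalWave.opNorm (d := d) p q F (FractalWave.halfWaveLoc φ j)) ∧
    -- the exponent `s_E(p,q)` cannot be lowered, whatever discretizations are chosen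
    (∀ E : Set ℝ, E ⊆ Set.Icc 1 2 → E.Nonempty → ∀ Ej : ℕ → Finset ℝ,
      (∀ j : ℕ, FractalWave.IsDiscretization E ((2 : ℝ) ^ j)⁻¹ (Ej j)) →
      ∀ p q : ℝ, 1 ≤ p → 1 < q → 1 / p + 1 / q < 1 →
      ∀ s : ℝ, s < FractalWave.criticalExponent d E p q →
        ¬ FractalWave.SmoothingEstimate d φ Ej p q s) ∧
    -- the exponent `s_E(q) = s_E(2,q)` in the square function estimate cannot be lowered
    (∀ E : Set ℝ, E ⊆ Set.Icc 1 2 → E.Nonempty → ∀ Ej : ℕ → Finset ℝ,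
      (∀ j : ℕ, FractalWave.IsDiscretization E ((2 : ℝ) ^ j)⁻¹ (Ej j)) →
      ∀ r q : ℝ, 2 ≤ r → r ≤ q →
      ∀ s : ℝ, s < FractalWave.criticalExponent d E 2 q →
        ¬ FractalWave.SquareFunctionEstimate d φ Ej r q s) := by
  obtain ⟨n, rfl⟩ : ∃ n, d = n + 1 := ⟨d - 1, by omega⟩
  obtain ⟨r₀, hr₀⟩ := hφne
  have hr₀pos : 0 < r₀ := by
    have := (hφsupp (subset_tsupport φ hr₀)).1
    linarith
  have hcs : HasCompactSupport φ :=
    HasCompactSupport.of_support_subset_isCompact (isCompact_Icc (a := (1 / 4 : ℝ)) (b := 4))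
      ((subset_tsupport φ).trans (hφsupp.trans Ioo_subset_Icc_self))
  obtain ⟨B, hB⟩ := hφ.continuous.bounded_above_of_compact_support hcs
  obtain ⟨L, hL⟩ := ContDiff.lipschitzWith_of_hasCompactSupport hcs hφ (by simp)
  have hLip : ∀ s, |φ s - φ r₀| ≤ L * |s - r₀| := fun s => by
    have := hL.dist_le_mul s r₀
    rwa [Real.dist_eq, Real.dist_eq] at this
  have core := fun {q : ℝ} (hq : 0 < q) => FractalWave.lowerQuantity_le_opNorm n hφ.continuous
    (B := B) hB L.2 hLip hr₀pos hr₀ hq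
  -- Any ρ₀ in (0,1) would do: the core bound holds as soon as 2^j|I| ≥ 1, and ρ^(d/q) ≤ 1 only
  -- weakens it.
  refine ⟨⟨1 / 2, by norm_num, by norm_num, fun q hq => ?_⟩, ?_, ?_⟩
  · have hq0 : 0 < q := by linarith
    obtain ⟨c₁, hc₁, h1⟩ := core hq0
    -- The constant cutoff ψ = 1 turns the localized propagator into the full one.
    obtain ⟨c₂, hc₂, h2⟩ := FractalWave.lowerQuantity_le_opNorm n (ψ := fun _ => 1)
      continuous_const (B := 1) (by simp) (L := 0) le_rfl (by simp) (r₀ := 1) one_pos one_ne_zero hq0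
    refine ⟨min c₁ c₂, lt_min hc₁ hc₂, ?_⟩
    intro ρ hρ hρ2 p hp _ E hE j F hF I ℓ hI hlo hhi
    have hR0 : (0 : ℝ) < 2 ^ j := by positivity
    have hℓ1 : ℓ ≤ 1 := by
      by_contra h
      push Not at h
      nlinarith
    have hRℓ : 1 ≤ (2 : ℝ) ^ j * ℓ := by
      refine le_trans ?_ hlo
      rw [one_le_inv₀ hρ]
      linarith
    have hℓ0 : 0 ≤ ℓ := by
      by_contra h
      push Not at h
      nlinarith
    have hlq := FractalWave.lowerQuantity_nonneg (d := n + 1) (p := p) (q := q) (E := E) (j := j)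
      (I := I) hℓ0
    have hρ1 : ρ ^ (((n + 1 : ℕ) : ℝ) / q) ≤ 1 :=
      Real.rpow_le_one hρ.le (by linarith) (by positivity)
    have hmin : 0 < min c₁ c₂ := lt_min hc₁ hc₂
    have hle : ∀ c, min c₁ c₂ ≤ c → ENNReal.ofReal (min c₁ c₂ * ρ ^ (((n + 1 : ℕ) : ℝ) / q) *
        FractalWave.lowerQuantity (n + 1) p q E j I ℓ) ≤
        ENNReal.ofReal (c * FractalWave.lowerQuantity (n + 1) p q E j I ℓ) := by
      intro c hc
      apply ENNReal.ofReal_le_ofReal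
      gcongr
      exact (mul_le_of_le_one_right hmin.le hρ1).trans hc
    refine ⟨?_, (hle c₁ (min_le_left _ _)).trans (h1 p hp E hE j F hF I ℓ hI hRℓ hℓ1)⟩
    have := h2 p hp E hE j F hF I ℓ hI hRℓ hℓ1
    rw [FractalWave.halfWaveLoc_one] at this
    exact (hle c₂ (min_le_right _ _)).trans this
  · intro E hE hne Ej hEj p q hp hq _ s hs hS
    have hq0 : 0 < q := by linarith
    obtain ⟨c, hc, h⟩ := core hq0
    exact absurd (FractalWave.criticalExponent_le_of_smoothingEstimate hq0 hc hne hEj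
      (fun j I ℓ => h p hp E hE j (Ej j) (hEj j) I ℓ) hS) (not_le.2 hs)
  · intro E hE hne Ej hEj r q hr hrq s hs hS
    have hq0 : 0 < q := by linarith
    obtain ⟨c, hc, h⟩ := core hq0
    exact absurd (FractalWave.criticalExponent_le_of_smoothingEstimate hq0 hc hne hEj
      (fun j I ℓ => h 2 (by norm_num) E hE j (Ej j) (hEj j) I ℓ)
      (hS.smoothingEstimate (by linarith) hrq)) (not_le.2 hs)
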